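/- A digraph is a pair $G=(V,E)$ with $V$ a nonempty set and $E\subseteq V^2$ (loops are allowed). Let $\mathcal{D}$ be the set of isomorphism types of finite digraphs, partially ordered by $G\sqsubseteq G'$ if and only if $G$ is isomorphic to the substructure of $G'$ induced on some subset of its vertices. For digraphs $C_1,\dots,C_k\in\mathcal{D}$, a relation $R\subseteq\mathcal{D}^n$ is definable in the first-order language of $(\mathcal{D};\sqsubseteq,C_1,\dots,C_k)$ if some first-order formula with free variables $x_1,\dots,x_n$, in the language of partially ordered sets with constants for $C_1,\dots,C_k$ added, holds exactly for the tuples in $R$; an element $G$ is definable if $\{G\}$ is. A digraph is weakly connected if it is connected when the direction of its edges is disregarded. The second-order language of digraphs has variables for finite digraphs, for vertices of a given digraph variable, and for relations $R\subseteq V(X_1)\times\dots\times V(X_m)$ between the vertex sets of given digraph variables $X_1,\dots,X_m$ (not necessarily distinct; this includes sets of vertices, relations on one digraph, and functions between two digraphs, as their graphs). Its atomic formulas express that two vertices of a digraph are equal, that they form an edge, or that a tuple of vertices belongs to a relation; formulas are built by the logical connectives and by quantification over all three kinds of variables. A formula $\varphi(X_1,\dots,X_n)$ whose only free variables are digraph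 variables defines an isomorphism-invariant relation between finite digraphs, hence a relation on $\mathcal{D}$. There exists a finite set $\{C_1,\dots,C_k\}$ of finite digraphs such that in the first-order language of $(\mathcal{D};\sqsubseteq,C_1,\dots,C_k)$ 1. every single digraph $G\in\mathcal{D}$ is definable; 2. the set of weakly connected digraphs is definable; 3. moreover, the full second-order language of digraphs is available: for every $n$, every $n$-ary relation on $\mathcal{D}$ that is defined by a formula $\varphi(X_1,\dots,X_n)$ of the second-order language of digraphs is definable. -/

import Mathlib

namespace DigraphOrder

open FirstOrder

/-- A finite directed graph (loops are allowed) with vertex set `{0, …, n}`. The vertex set of a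
digraph is nonempty; every finite digraph is isomorphic to one of these. -/
structure FinDigraph where
  n : ℕ
  graph : Digraph (Fin (n + 1))

namespace FinDigraph

/-- The set of vertices. -/
abbrev V (G : FinDigraph) : Type := Fin (G.n + 1)

/-- The edge relation. -/
abbrev E (G : FinDigraph) : G.V → G.V → Prop := G.graph.Adj

/-- `G` is isomorphic to the substructure of `H` induced on some subset of the vertices. -/
def Substructure (G H : FinDigraph) : Prop := Nonempty (G.E ↪r H.E)

/-- `G` and `H` are isomorphic. -/
def Isomorphic (G H : FinDigraph) : Prop := Nonempty (G.E ≃r H.E)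

/-- Disregarding the direction of the edges, the graph is connected. -/
def WeaklyConnected (G : FinDigraph) : Prop := G.graph.toSimpleGraphInclusive.Connected

theorem Substructure.antisymm {G H : FinDigraph} (h₁ : G.Substructure H) (h₂ : H.Substructure G) :
    G.Isomorphic H := by
  obtain ⟨f⟩ := h₁
  obtain ⟨g⟩ := h₂
  have h : Function.Bijective f := by
    rw [Fintype.bijective_iff_injective_and_card]
    exact ⟨f.injective, le_antisymm (Fintype.card_le_of_injective f f.injective)
      (Fintype.card_le_of_injective g g.injective)⟩
  exact ⟨RelIso.ofSurjective f h.2⟩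

instance setoid : Setoid FinDigraph where
  r := Isomorphic
  iseqv := ⟨fun _ => ⟨RelIso.refl _⟩, fun ⟨f⟩ => ⟨f.symm⟩, fun ⟨f⟩ ⟨g⟩ => ⟨f.trans g⟩⟩

end FinDigraph

/-- The set of isomorphism types of finite digraphs. -/
def IsoType : Type := Quotient FinDigraph.setoid

namespace IsoType

/-- The isomorphism type of a finite digraph. -/
def of (G : FinDigraph) : IsoType := Quotient.mk FinDigraph.setoid G

/-- The poset of isomorphism types of finite digraphs: `≤` is the substructure ordering. -/
instance : PartialOrder IsoType where
  le := Quotient.lift₂ FinDigraph.Substructure (by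
    rintro G₁ H₁ G₂ H₂ ⟨f⟩ ⟨g⟩
    exact propext
      ⟨fun ⟨e⟩ => ⟨(f.symm.toRelEmbedding.trans e).trans g.toRelEmbedding⟩,
        fun ⟨e⟩ => ⟨(f.toRelEmbedding.trans e).trans g.symm.toRelEmbedding⟩⟩)
  le_refl x := by
    induction x using Quotient.ind
    exact ⟨RelEmbedding.refl _⟩
  le_trans x y z := by
    induction x using Quotient.ind
    induction y using Quotient.ind
    induction z using Quotient.ind
    rintro ⟨f⟩ ⟨g⟩
    exact ⟨f.trans g⟩
  le_antisymm x y := by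
    induction x using Quotient.ind
    induction y using Quotient.ind
    intro h₁ h₂
    exact Quotient.sound (FinDigraph.Substructure.antisymm h₁ h₂)

/-- The poset as a structure for the first-order language of partially ordered sets. -/
instance : Language.order.Structure IsoType := Language.orderStructure IsoType

/-- The set of (isomorphism types of) weakly connected digraphs. -/
def weaklyConnected : Set IsoType := {x | ∃ G : FinDigraph, of G = x ∧ G.WeaklyConnected}

end IsoType

/-! ### The second-order language of digraphs

A many-sorted language. Its variables are: digraph variables; for each digraph variable, variables
for the vertices of that digraph; for each finite list of digraph variables `X₁, …, X_k`, variables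
for the relations `R ⊆ V(X₁) × ⋯ × V(X_k)` (in particular sets of vertices, relations of any arity
on one digraph, and graphs of functions from one digraph to another). One may quantify over all
of these; the atomic formulas say that two vertices of a digraph are equal, that they form an edge,
or that a tuple of vertices belongs to a relation. -/

/-- The variables that may occur free in a formula, with their sorts. -/
structure SOContext : Type 1 where
  /-- the digraph variables -/
  Dig : Type
  /-- the variables for vertices of a digraph -/
  Vtx : Dig → Type
  /-- the variables for relations between the vertices of some digraphs -/
  Rel : {k : ℕ} → (Fin k → Dig) → Type

namespace SOContext

/-- The context with `n` digraph variables and no others. -/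
def digraphs (n : ℕ) : SOContext := ⟨Fin n, fun _ => Empty, fun _ => Empty⟩

inductive VtxLift {D : Type} (Vtx : D → Type) : Option D → Type
  | old {i : D} (x : Vtx i) : VtxLift Vtx (some i)

inductive RelLift {D : Type} (Rel : {k : ℕ} → (Fin k → D) → Type) :
    {k : ℕ} → (Fin k → Option D) → Type
  | old {k : ℕ} {s : Fin k → D} (R : Rel s) : RelLift Rel (fun j => some (s j))

inductive VtxExt {D : Type} (Vtx : D → Type) (i : D) : D → Type
  | old {j : D} (x : Vtx j) : VtxExt Vtx i j
  | new : VtxExt Vtx i i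

inductive RelExt {D : Type} (Rel : {k : ℕ} → (Fin k → D) → Type) {m : ℕ} (t : Fin m → D) :
    {k : ℕ} → (Fin k → D) → Type
  | old {k : ℕ} {s : Fin k → D} (R : Rel s) : RelExt Rel t s
  | new : RelExt Rel t t

/-- Add a digraph variable. -/
def addDig (c : SOContext) : SOContext := ⟨Option c.Dig, VtxLift c.Vtx, RelLift c.Rel⟩

/-- Add a variable for a vertex of the digraph `i`. -/
def addVtx (c : SOContext) (i : c.Dig) : SOContext := ⟨c.Dig, VtxExt c.Vtx i, c.Rel⟩

/-- Add a variable for a relation between vertices of the digraphs `t 0, …, t (m - 1)`. -/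
def addRel (c : SOContext) {m : ℕ} (t : Fin m → c.Dig) : SOContext :=
  ⟨c.Dig, c.Vtx, RelExt c.Rel t⟩

/-- An interpretation of the variables of a context. -/
structure Assignment (c : SOContext) where
  dig : c.Dig → FinDigraph
  vtx : (i : c.Dig) → c.Vtx i → (dig i).V
  rel : (k : ℕ) → (s : Fin k → c.Dig) → c.Rel s → Set ((j : Fin k) → (dig (s j)).V)

namespace Assignment

/-- The interpretation of `n` digraph variables by given digraphs. -/
def ofDigraphs {n : ℕ} (G : Fin n → FinDigraph) : Assignment (digraphs n) where
  dig := G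
  vtx := fun _ x => nomatch x
  rel := fun _ _ x => nomatch x

/-- Interpret the new digraph variable by `G`. -/
def addDig {c : SOContext} (a : Assignment c) (G : FinDigraph) : Assignment c.addDig where
  dig
    | none => G
    | some i => a.dig i
  vtx
    | _, VtxLift.old x => a.vtx _ x
  rel
    | _, _, RelLift.old R => a.rel _ _ R

/-- Interpret the new vertex variable by `v`. -/
def addVtx {c : SOContext} (a : Assignment c) (i : c.Dig) (v : (a.dig i).V) :
    Assignment (c.addVtx i) where
  dig := a.dig
  vtx
    | _, VtxExt.old x => a.vtx _ x
    | _, VtxExt.new => v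
  rel := a.rel

/-- Interpret the new relation variable by `S`. -/
def addRel {c : SOContext} (a : Assignment c) {m : ℕ} (t : Fin m → c.Dig)
    (S : Set ((j : Fin m) → (a.dig (t j)).V)) : Assignment (c.addRel t) where
  dig := a.dig
  vtx := a.vtx
  rel
    | _, _, RelExt.old R => a.rel _ _ R
    | _, _, RelExt.new => S

end Assignment

end SOContext

/-- The second-order formulas about digraphs with free variables in a given context. The other
connectives and the existential quantifiers are abbreviations. -/
inductive SOFormula : SOContext → Type 1
  | falsum {c : SOContext} : SOFormula c
  | eq {c : SOContext} {i : c.Dig} (x y : c.Vtx i) : SOFormula c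
  | edge {c : SOContext} {i : c.Dig} (x y : c.Vtx i) : SOFormula c
  | mem {c : SOContext} {k : ℕ} {s : Fin k → c.Dig} (R : c.Rel s) (x : (j : Fin k) → c.Vtx (s j)) :
      SOFormula c
  | imp {c : SOContext} (φ ψ : SOFormula c) : SOFormula c
  | allDig {c : SOContext} (φ : SOFormula c.addDig) : SOFormula c
  | allVtx {c : SOContext} (i : c.Dig) (φ : SOFormula (c.addVtx i)) : SOFormula c
  | allRel {c : SOContext} {m : ℕ} (t : Fin m → c.Dig) (φ : SOFormula (c.addRel t)) : SOFormula c

namespace SOFormula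

/-- Truth of a second-order formula. -/
def Realize : {c : SOContext} → SOFormula c → c.Assignment → Prop
  | _, falsum, _ => False
  | _, eq x y, a => a.vtx _ x = a.vtx _ y
  | _, @edge _ i x y, a => (a.dig i).E (a.vtx i x) (a.vtx i y)
  | _, mem R x, a => (fun j => a.vtx _ (x j)) ∈ a.rel _ _ R
  | _, imp φ ψ, a => φ.Realize a → ψ.Realize a
  | _, allDig φ, a => ∀ G : FinDigraph, φ.Realize (a.addDig G)
  | _, allVtx i φ, a => ∀ v : (a.dig i).V, φ.Realize (a.addVtx i v)
  | _, allRel t φ, a => ∀ S : Set ((j : _) → (a.dig (t j)).V), φ.Realize (a.addRel t S)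

/-- The relation on isomorphism types that a second-order formula in `n` free digraph variables
defines. -/
def relation {n : ℕ} (φ : SOFormula (SOContext.digraphs n)) : Set (Fin n → IsoType) :=
  {v | ∃ G : Fin n → FinDigraph, (∀ i, IsoType.of (G i) = v i) ∧
    φ.Realize (SOContext.Assignment.ofDigraphs G)}

end SOFormula

end DigraphOrder

/-! The constants are the digraphs with at most four vertices (`small`). With them the order
expresses which patterns of at most four vertices occur in a digraph. Hence linear orders are
definable, and the reflexive ones, `num n`, serve as natural numbers.

A linear order together with vertices of the opposite loop type, each joined to initial segments of
it, codes a finite binary relation on numbers: the lengths of the two segments of a vertex form a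
pair (`memL_lbl`, `exists_code`). Quantifying over such codes one can speak about coded digraphs
`dec k S`, their patterns, sizes and embeddings (`hasCode_iff`, `szCode_iff`, `embCode_iff`).

The crux is to define the relation "`X` is the digraph coded by `S`" (`Def.decode`). This is a
bootstrap. If the elements of a set `N` can be decoded, so can the digraphs determined by their
patterns, their numbers of looped and loopless vertices, and their position in the order relative to
`N`, because all these data are expressible both for `X` and for a code (`Coded.det`). Starting from
the linear orders, nine such enlargements reach every digraph (`det_chain`).

Once digraphs can be decoded, a second-order formula is translated by letting numbers and codes
stand for vertices, digraphs and relations (`exists_translation`, `def_relation`). -/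

namespace DigraphOrder

open FirstOrder

/-! ### Isomorphism types and their representatives -/

namespace IsoType

/-- The vertex set of a representative. -/
abbrev V (X : IsoType) : Type := (Quotient.out X).V

/-- The edge relation of a representative. -/
abbrev E (X : IsoType) : X.V → X.V → Prop := (Quotient.out X).E

theorem of_out (X : IsoType) : of (Quotient.out X) = X := Quotient.out_eq X

theorem of_le_of {G H : FinDigraph} : of G ≤ of H ↔ Nonempty (G.E ↪r H.E) := Iff.rfl

theorem of_eq_of {G H : FinDigraph} : of G = of H ↔ Nonempty (G.E ≃r H.E) :=
  ⟨fun h => Quotient.exact h, fun h => Quotient.sound h⟩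

theorem le_iff {X Y : IsoType} : X ≤ Y ↔ Nonempty (X.E ↪r Y.E) := by
  conv_lhs => rw [← of_out X, ← of_out Y]
  exact of_le_of

theorem eq_iff {X Y : IsoType} : X = Y ↔ Nonempty (X.E ≃r Y.E) := by
  conv_lhs => rw [← of_out X, ← of_out Y]
  exact of_eq_of

/-- The isomorphism type of a relation on a finite nonempty type. -/
noncomputable def mk {V : Type} [Finite V] [Nonempty V] (r : V → V → Prop) : IsoType :=
  -- A `FinDigraph` with parameter `n` has `n + 1` vertices.
  of ⟨Nat.card V - 1, ⟨fun i j =>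
    r ((finCongr (Nat.sub_add_cancel Nat.card_pos)).trans (Finite.equivFin V).symm i)
      ((finCongr (Nat.sub_add_cancel Nat.card_pos)).trans (Finite.equivFin V).symm j)⟩⟩

theorem nonempty_of_iso (G : FinDigraph) : Nonempty ((of G).E ≃r G.E) :=
  of_eq_of.1 (of_out (of G))

section

variable {V W : Type} [Finite V] [Nonempty V] [Finite W] [Nonempty W]

theorem nonempty_mk_iso (r : V → V → Prop) : Nonempty ((mk r).E ≃r r) := by
  obtain ⟨e⟩ := nonempty_of_iso ⟨Nat.card V - 1, ⟨fun i j =>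
    r ((finCongr (Nat.sub_add_cancel Nat.card_pos)).trans (Finite.equivFin V).symm i)
      ((finCongr (Nat.sub_add_cancel Nat.card_pos)).trans (Finite.equivFin V).symm j)⟩⟩
  exact ⟨e.trans ⟨_, Iff.rfl⟩⟩

/-- The representative of `mk r` is isomorphic to `r`. -/
noncomputable def mkIso (r : V → V → Prop) : (mk r).E ≃r r := (nonempty_mk_iso r).some

theorem mk_le {r : V → V → Prop} {Y : IsoType} : mk r ≤ Y ↔ Nonempty (r ↪r Y.E) := by
  rw [le_iff]
  exact ⟨fun ⟨e⟩ => ⟨(mkIso r).symm.toRelEmbedding.trans e⟩,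
    fun ⟨e⟩ => ⟨(mkIso r).toRelEmbedding.trans e⟩⟩

theorem le_mk {r : V → V → Prop} {Y : IsoType} : Y ≤ mk r ↔ Nonempty (Y.E ↪r r) := by
  rw [le_iff]
  exact ⟨fun ⟨e⟩ => ⟨e.trans (mkIso r).toRelEmbedding⟩,
    fun ⟨e⟩ => ⟨e.trans (mkIso r).symm.toRelEmbedding⟩⟩

theorem mk_le_mk {r : V → V → Prop} {s : W → W → Prop} : mk r ≤ mk s ↔ Nonempty (r ↪r s) := by
  rw [mk_le]
  exact ⟨fun ⟨e⟩ => ⟨e.trans (mkIso s).toRelEmbedding⟩,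
    fun ⟨e⟩ => ⟨e.trans (mkIso s).symm.toRelEmbedding⟩⟩

theorem mk_eq_mk {r : V → V → Prop} {s : W → W → Prop} (e : r ≃r s) : mk r = mk s :=
  eq_iff.2 ⟨((mkIso r).trans e).trans (mkIso s).symm⟩

end

theorem mk_E (X : IsoType) : mk X.E = X := eq_iff.2 ⟨mkIso X.E⟩

end IsoType

open IsoType

/-! ### Counting vertices by loop type; patterns of four vertices -/

/-- An embedding between finite relations of the same size is onto. -/
theorem surjective_of_card {V W : Type} [Finite W] {f : V → W}
    (hf : Function.Injective f) (h : Nat.card W ≤ Nat.card V) : Function.Surjective f := by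
  have := Finite.of_injective f hf
  exact (hf.bijective_of_nat_card_le h).2

/-- The number of vertices that carry a loop (`l` true) or do not (`l` false). -/
noncomputable def sz (l : Prop) {V : Type} (r : V → V → Prop) : ℕ := Nat.card {x // r x x ↔ l}

theorem sz_iso {V W : Type} {r : V → V → Prop} {s : W → W → Prop} (e : r ≃r s) (l : Prop) :
    sz l r = sz l s :=
  Nat.card_congr (e.toEquiv.subtypeEquiv fun a => by
    have := e.map_rel_iff (a := a) (b := a)
    rw [← this]; rfl)

theorem sz_le {V W : Type} [Finite W] {r : V → V → Prop} {s : W → W → Prop} (e : r ↪r s)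
    (l : Prop) : sz l r ≤ sz l s :=
  Nat.card_le_card_of_injective
    (fun x : {x // r x x ↔ l} => (⟨e x, by rw [e.map_rel_iff]; exact x.2⟩ : {x // s x x ↔ l}))
    fun x y h => by simpa [Subtype.ext_iff] using h

/-- If an embedding does not lose vertices of type `l`, it covers them all. -/
theorem covers {V W : Type} [Finite W] {r : V → V → Prop} {s : W → W → Prop} (e : r ↪r s)
    (l : Prop) (h : sz l s ≤ sz l r) {y : W} (hy : s y y ↔ l) : ∃ x, e x = y := by
  have hf : Function.Injective
      (fun x : {x // r x x ↔ l} => (⟨e x, by rw [e.map_rel_iff]; exact x.2⟩ : {x // s x x ↔ l})) :=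
    fun x y h => by simpa [Subtype.ext_iff] using h
  obtain ⟨x, hx⟩ := surjective_of_card hf h ⟨y, hy⟩
  exact ⟨x, congrArg Subtype.val hx⟩

theorem iff_or_iff_not (p l : Prop) : (p ↔ l) ∨ (p ↔ ¬l) := by tauto

theorem iff_not_iff {p l : Prop} : ¬(p ↔ l) ↔ (p ↔ ¬l) := by tauto

theorem surjective_of_sz {V W : Type} [Finite W] {r : V → V → Prop} {s : W → W → Prop}
    (e : r ↪r s) (l : Prop) (h : sz l s ≤ sz l r) (h' : sz (¬l) s ≤ sz (¬l) r) :
    Function.Surjective e := fun y => by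
  rcases iff_or_iff_not (s y y) l with hy | hy
  · exact covers e l h hy
  · exact covers e (¬l) h' hy

theorem sz_mk {V : Type} [Finite V] [Nonempty V] (r : V → V → Prop) (l : Prop) :
    sz l (mk r).E = sz l r := sz_iso (mkIso r) l

theorem eq_of_le_of_sz {X Y : IsoType} (h : X ≤ Y) (hs : ∀ l, sz l Y.E ≤ sz l X.E) : X = Y := by
  obtain ⟨e⟩ := le_iff.1 h
  exact eq_iff.2 ⟨RelIso.ofSurjective e (surjective_of_sz e True (hs _) (hs _))⟩

/-- Some four vertices (not necessarily distinct) have the given edges and equalities. -/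
def Has (t : (Fin 4 → Fin 4 → Prop) × (Fin 4 → Fin 4 → Prop)) {V : Type} (r : V → V → Prop) :
    Prop :=
  ∃ w : Fin 4 → V, ∀ a b, (r (w a) (w b) ↔ t.1 a b) ∧ (w a = w b ↔ t.2 a b)

theorem Has.mono {t} {V W : Type} {r : V → V → Prop} {s : W → W → Prop} (e : r ↪r s)
    (h : Has t r) : Has t s := by
  obtain ⟨w, hw⟩ := h
  exact ⟨e ∘ w, fun a b => by simpa [e.map_rel_iff] using hw a b⟩

theorem has_iso {t} {V W : Type} {r : V → V → Prop} {s : W → W → Prop} (e : r ≃r s) :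
    Has t r ↔ Has t s :=
  ⟨Has.mono e.toRelEmbedding, Has.mono e.symm.toRelEmbedding⟩

theorem has_mk {t} {V : Type} [Finite V] [Nonempty V] (r : V → V → Prop) :
    Has t (mk r).E ↔ Has t r := has_iso (mkIso r)

/-- The digraphs with at most four vertices. -/
noncomputable def small : Finset IsoType := by
  classical
  exact Finset.univ.image fun p : (Σ k : Fin 4, (Fin (k + 1) → Fin (k + 1) → Prop)) => mk p.2

theorem mk_mem_small {V : Type} [Finite V] [Nonempty V] (r : V → V → Prop) (h : Nat.card V ≤ 4) :
    mk r ∈ small := by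
  classical
  have hp : 0 < Nat.card V := Nat.card_pos
  have e : Fin ((⟨Nat.card V - 1, by omega⟩ : Fin 4) + 1) ≃ V :=
    (finCongr (by simp; omega)).trans (Finite.equivFin V).symm
  refine Finset.mem_image.2 ⟨⟨⟨Nat.card V - 1, by omega⟩, fun i j => r (e i) (e j)⟩,
    Finset.mem_univ _, ?_⟩
  exact mk_eq_mk ⟨e, Iff.rfl⟩

/-- A pattern is already realized in the substructure induced on its own vertices, of which there
are at most four. -/
theorem has_iff_small {t} {X : IsoType} : Has t X.E ↔ ∃ q ∈ small, Has t q.E ∧ q ≤ X := by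
  constructor
  · rintro ⟨w, hw⟩
    refine ⟨mk (Subrel X.E (· ∈ Set.range w)), mk_mem_small _ ?_, ?_, ?_⟩
    · exact (Nat.card_le_card_of_surjective _ (Set.rangeFactorization_surjective (f := w))).trans
        (by simp)
    · rw [has_mk]
      exact ⟨fun a => ⟨w a, a, rfl⟩, fun a b => by simpa [Subrel, Subtype.ext_iff] using hw a b⟩
    · exact mk_le.2 ⟨Subrel.relEmbedding _ _⟩
  · rintro ⟨q, -, h, hq⟩
    exact h.mono (le_iff.1 hq).some

/-! ### Definable predicates -/

/-- Definability from the order and the small digraphs. -/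
def Def {α : Type} (p : (α → IsoType) → Prop) : Prop :=
  (small : Set IsoType).Definable Language.order {v | p v}

namespace Def

variable {α β : Type}

theorem congr {p q : (α → IsoType) → Prop} (hp : Def p) (h : ∀ v, p v ↔ q v) : Def q := by
  rwa [show q = p from funext fun v => propext (h v).symm]

theorem not {p : (α → IsoType) → Prop} (hp : Def p) : Def fun v => ¬p v := hp.compl

theorem and {p q : (α → IsoType) → Prop} (hp : Def p) (hq : Def q) : Def fun v => p v ∧ q v :=
  hp.inter hq

theorem or {p q : (α → IsoType) → Prop} (hp : Def p) (hq : Def q) : Def fun v => p v ∨ q v :=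
  hp.union hq

theorem imp {p q : (α → IsoType) → Prop} (hp : Def p) (hq : Def q) : Def fun v => p v → q v :=
  ((hp.not).or hq).congr fun _ => imp_iff_not_or.symm

theorem iff {p q : (α → IsoType) → Prop} (hp : Def p) (hq : Def q) : Def fun v => p v ↔ q v :=
  ((hp.imp hq).and (hq.imp hp)).congr fun _ => iff_def.symm

theorem const (P : Prop) : Def fun _ : α → IsoType => P := by
  by_cases h : P
  · simp [Def, h]
  · simp [Def, h]

theorem comp {p : (α → IsoType) → Prop} (hp : Def p) (f : α → β) :
    Def fun v : β → IsoType => p fun a => v (f a) := hp.preimage_comp f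

theorem exs {p : (α → IsoType) → (β → IsoType) → Prop} [Finite β]
    (hp : Def fun w : α ⊕ β → IsoType => p (fun a => w (.inl a)) (fun b => w (.inr b))) :
    Def fun v => ∃ x, p v x := by
  obtain ⟨φ, hφ⟩ := hp
  refine ⟨φ.iExs β, ?_⟩
  ext v
  simp only [Set.mem_ofPred_eq, Language.Formula.realize_iExs]
  refine exists_congr fun x => ?_
  have := Set.ext_iff.1 hφ (Sum.elim v x)
  simpa using this

theorem ex {p : (α → IsoType) → IsoType → Prop}
    (hp : Def fun w : α ⊕ Unit → IsoType => p (fun a => w (.inl a)) (w (.inr ()))) :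
    Def fun v => ∃ x, p v x :=
  (exs (p := fun v x => p v (x ())) hp).congr fun _ =>
    ⟨fun ⟨x, h⟩ => ⟨x (), h⟩, fun ⟨x, h⟩ => ⟨fun _ => x, h⟩⟩

theorem alls {p : (α → IsoType) → (β → IsoType) → Prop} [Finite β]
    (hp : Def fun w : α ⊕ β → IsoType => p (fun a => w (.inl a)) (fun b => w (.inr b))) :
    Def fun v => ∀ x, p v x :=
  (exs (p := fun v x => ¬p v x) hp.not).not.congr fun _ => by simp

theorem all {p : (α → IsoType) → IsoType → Prop}
    (hp : Def fun w : α ⊕ Unit → IsoType => p (fun a => w (.inl a)) (w (.inr ()))) :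
    Def fun v => ∀ x, p v x :=
  (ex (p := fun v x => ¬p v x) hp.not).not.congr fun v => by simp

/-- Among the finite index types used are `Prop`, whose two elements are the loop flags, and the
type of all four-vertex patterns. -/
theorem forall_fin {ι : Sort*} [Finite ι] {p : ι → (α → IsoType) → Prop} (hp : ∀ i, Def (p i)) :
    Def fun v => ∀ i, p i v := by
  have := Set.definable_iInter_of_finite (ι := PLift ι) fun i => hp i.down
  have h : ( ⋂ i : PLift ι, {v | p (PLift.down i) v}) = {v | ∀ i, p i v} := by
    ext v
    simp [PLift.forall]
  rwa [h] at this

theorem exists_fin {ι : Sort*} [Finite ι] {p : ι → (α → IsoType) → Prop} (hp : ∀ i, Def (p i)) :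
    Def fun v => ∃ i, p i v :=
  (forall_fin fun i => (hp i).not).not.congr fun v => by simp

theorem le (i j : α) : Def fun v => v i ≤ v j := by
  have : Language.order.OrderedStructure IsoType := ⟨fun _ => Iff.rfl⟩
  refine Set.Definable.mono ?_ (Set.empty_subset _)
  rw [Set.empty_definable_iff]
  exact ⟨(Language.var (Sum.inl i)).le (Language.var (Sum.inl j)), by
    ext v; simp [Language.Formula.Realize, Language.Term.realize_le]⟩

theorem eq (i j : α) : Def fun v => v i = v j :=
  ((le i j).and (le j i)).congr fun _ => antisymm_iff

theorem eq_const {q : IsoType} (hq : q ∈ small) (i : α) : Def fun v => v i = q := by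
  have : Def fun v : Fin 1 → IsoType => v 0 = q :=
    Set.Definable.singleton_of_mem (L := Language.order) (A := (small : Set IsoType)) hq
  exact this.comp fun _ => i

theorem const_le {q : IsoType} (hq : q ∈ small) (i : α) : Def fun v => q ≤ v i :=
  (ex (p := fun v x => x = q ∧ x ≤ v i) ((eq_const hq _).and (le _ _))).congr fun v => by simp

theorem has (t) (i : α) : Def fun v => Has t (v i).E :=
  (exists_fin fun q : small => (const (Has t q.1.E)).and (const_le q.2 i)).congr fun v => by
    rw [has_iff_small]
    exact ⟨fun ⟨q, h⟩ => ⟨q.1, q.2, h⟩, fun ⟨q, hq, h⟩ => ⟨⟨q, hq⟩, h⟩⟩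

/-- A universal property of quadruples of vertices is definable. -/
theorem forall_vertices (θ : (Fin 4 → Fin 4 → Prop) → (Fin 4 → Fin 4 → Prop) → Prop) (i : α) :
    Def fun v => ∀ w : Fin 4 → (v i).V, θ (fun a b => (v i).E (w a) (w b)) (fun a b => w a = w b) :=
  -- A quadruple matters only through its pattern of edges and equalities, and there are finitely
  -- many patterns.
  (forall_fin fun t => (has t i).imp (const (θ t.1 t.2))).congr fun v => by
    refine ⟨fun h w => ?_, ?_⟩
    · exact h (fun a b => (v i).E (w a) (w b), fun a b => w a = w b) ⟨w, fun a b => ⟨.rfl, .rfl⟩⟩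
    · rintro h ⟨t₁, t₂⟩ ⟨w, hw⟩
      have := h w
      rwa [show (fun a b => (v i).E (w a) (w b)) = t₁ from
          funext₂ fun a b => propext (hw a b).1,
        show (fun a b => w a = w b) = t₂ from funext₂ fun a b => propext (hw a b).2] at this

end Def

/-! ### Linear orders -/

/-- The linear order on `n + 1` points, with loops if `l`. -/
def linRel (l : Prop) (n : ℕ) (i j : Fin (n + 1)) : Prop := i < j ∨ i = j ∧ l

/-- The isomorphism type of the linear order on `n + 1` points. -/
noncomputable def lin (l : Prop) (n : ℕ) : IsoType := mk (linRel l n)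

/-- The reflexive linear orders play the role of the natural numbers. -/
noncomputable abbrev num (n : ℕ) : IsoType := lin True n

theorem linRel_self {l : Prop} {n : ℕ} (i : Fin (n + 1)) : linRel l n i i ↔ l := by
  simp [linRel]

theorem linRel_of_ne {l : Prop} {n : ℕ} {i j : Fin (n + 1)} (h : i ≠ j) :
    linRel l n i j ↔ i < j := by
  simp [linRel, h]

theorem sz_linRel (l : Prop) (n : ℕ) : sz l (linRel l n) = n + 1 := by
  simp [sz, linRel_self]

theorem sz_not_linRel (l : Prop) (n : ℕ) : sz (¬l) (linRel l n) = 0 := by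
  simp [sz, linRel_self]

theorem loop_map {V W : Type} {r : V → V → Prop} {s : W → W → Prop} (e : r ↪r s) {l : Prop}
    {x : V} (h : r x x ↔ l) : s (e x) (e x) ↔ l := by
  rwa [e.map_rel_iff]

/-- Two copies of a finite linear order with the same vertices are equal. -/
theorem lin_unique {V : Type} {s : V → V → Prop} {l : Prop} {n : ℕ} (f g : linRel l n ↪r s)
    (h : ∀ i, ∃ j, g j = f i) (i : Fin (n + 1)) : f i = g i := by
  choose k hk using h
  have hk' : StrictMono k := fun a b hab => by
    have hne : k a ≠ k b := fun he => hab.ne (f.injective (by rw [← hk, ← hk, he]))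
    have : linRel l n a b := Or.inl hab
    rw [← f.map_rel_iff, ← hk, ← hk, g.map_rel_iff, linRel_of_ne hne] at this
    exact this
  have : k = id := (hk'.range_inj strictMono_id).1 (by
    rw [Set.range_id, (Finite.surjective_of_injective hk'.injective).range_eq])
  rw [← hk, this, id]

/-- The vertices of type `l` form a linear order. -/
def LinPart (l : Prop) {V : Type} (r : V → V → Prop) : Prop :=
  ∀ x y z, (r x x ↔ l) → (r y y ↔ l) → (r z z ↔ l) → x ≠ y →
    (r x y ↔ ¬r y x) ∧ (y ≠ z → r x y → r y z → r x z)

theorem LinPart.of_embedding {l : Prop} {V W : Type} {r : V → V → Prop} {s : W → W → Prop}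
    (e : r ↪r s) (h : LinPart l s) : LinPart l r := fun x y z hx hy hz hxy => by
  have := h (e x) (e y) (e z) (loop_map e hx) (loop_map e hy) (loop_map e hz)
    (e.injective.ne hxy)
  simpa only [e.map_rel_iff, ne_eq, e.injective.eq_iff] using this

theorem linPart_linRel (l : Prop) (n : ℕ) : LinPart l (linRel l n) := fun x y z _ _ _ hxy => by
  rw [linRel_of_ne hxy, linRel_of_ne hxy.symm]
  refine ⟨by omega, fun hyz h₁ h₂ => ?_⟩
  rw [linRel_of_ne hyz] at h₂
  exact Or.inl (h₁.trans h₂)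

/-- Off the diagonal the relation is total, asymmetric and transitive on the vertices of type `l`,
hence a strict linear order, which can be enumerated increasingly. -/
theorem LinPart.exists_lin {l : Prop} {V : Type} [Finite V] {r : V → V → Prop}
    (h : LinPart l r) {n : ℕ} (hn : sz l r = n + 1) : Nonempty (linRel l n ↪r r) := by
  classical
  let T := {x // r x x ↔ l}
  let lt : T → T → Prop := fun x y => x ≠ y ∧ r x y
  have htr : ∀ x y z : T, lt x y → lt y z → lt x z := fun x y z h₁ h₂ => by
    have hxy : x.1 ≠ y.1 := fun e => h₁.1 (Subtype.ext e)
    have hyz : y.1 ≠ z.1 := fun e => h₂.1 (Subtype.ext e)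
    refine ⟨?_, (h x y z x.2 y.2 z.2 hxy).2 hyz h₁.2 h₂.2⟩
    rintro rfl
    exact (h x y x x.2 y.2 x.2 hxy).1.1 h₁.2 h₂.2
  let _ : LinearOrder T := {
    lt := lt
    le := fun x y => x = y ∨ lt x y
    le_refl := fun x => .inl rfl
    le_trans := by
      rintro x y z (rfl | h₁) (rfl | h₂)
      · exact .inl rfl
      · exact .inr h₂
      · exact .inr h₁
      · exact .inr (htr x y z h₁ h₂)
    lt_iff_le_not_ge := fun x y => by
      constructor
      · refine fun h₁ => ⟨.inr h₁, ?_⟩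
        rintro (rfl | h₂)
        · exact h₁.1 rfl
        · exact (htr _ _ _ h₁ h₂).1 rfl
      · rintro ⟨rfl | h₁, h₂⟩
        · exact (h₂ (.inl rfl)).elim
        · exact h₁
    le_antisymm := by
      rintro x y (rfl | h₁) (h₂ | h₂)
      · rfl
      · rfl
      · exact h₂.symm
      · exact ((htr _ _ _ h₁ h₂).1 rfl).elim
    le_total := fun x y => by
      by_cases hxy : x = y
      · exact .inl (.inl hxy)
      · have := (h x y x x.2 y.2 x.2 fun e => hxy (Subtype.ext e)).1
        by_cases hr : r x y
        · exact .inl (.inr ⟨hxy, hr⟩)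
        · exact .inr (.inr ⟨Ne.symm hxy, by tauto⟩)
    toDecidableLE := Classical.decRel _ }
  have _ : Fintype T := Fintype.ofFinite T
  have hc : Fintype.card T = n + 1 := by rw [← Nat.card_eq_fintype_card]; exact hn
  let e := Fintype.orderIsoFinOfCardEq T hc
  refine ⟨⟨⟨fun i => (e i).1, fun i j hij => e.injective (Subtype.ext hij)⟩, fun {i j} => ?_⟩⟩
  by_cases hij : i = j
  · subst hij
    exact (e i).2.trans (linRel_self i).symm
  · rw [linRel_of_ne hij, ← e.lt_iff_lt]
    have hne : e i ≠ e j := e.injective.ne hij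
    exact ⟨fun h' => ⟨hne, h'⟩, fun h' => h'.2⟩

theorem sz_eq_card {V : Type} {r : V → V → Prop} {l : Prop} (h : ∀ x, r x x ↔ l) :
    sz l r = Nat.card V := by
  simp [sz, h]

theorem sz_eq_zero {V : Type} {r : V → V → Prop} {l : Prop} (h : ∀ x, r x x ↔ l) :
    sz (¬l) r = 0 := by
  simp [sz, h]

theorem eq_lin {X : IsoType} {l : Prop} (h : ∀ x, X.E x x ↔ l) (h' : LinPart l X.E) :
    X = lin l (Nat.card X.V - 1) := by
  have : 0 < Nat.card X.V := Nat.card_pos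
  have hs : sz l X.E = Nat.card X.V - 1 + 1 := by rw [sz_eq_card h]; omega
  refine (eq_of_le_of_sz (mk_le.2 (h'.exists_lin hs)) fun l' => ?_).symm
  have : sz l' X.E ≤ sz l' (linRel l (Nat.card X.V - 1)) := by
    rcases iff_or_iff_not l' l with hl | hl <;> rw [hl]
    · rw [hs, sz_linRel]
    · rw [sz_eq_zero h]
      exact Nat.zero_le _
  rwa [← sz_mk (linRel l _)] at this

theorem loop_lin (l : Prop) (n : ℕ) (x : (lin l n).V) : (lin l n).E x x ↔ l := by
  have := (mkIso (linRel l n)).map_rel_iff (a := x) (b := x)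
  rw [linRel_self] at this
  exact this.symm

theorem linPart_lin (l : Prop) (n : ℕ) : LinPart l (lin l n).E :=
  (linPart_linRel l n).of_embedding (mkIso (linRel l n)).toRelEmbedding

/-- The right-hand side concerns at most three vertices at a time, which makes linear orders
definable. -/
theorem exists_eq_lin_iff {X : IsoType} {l : Prop} :
    (∃ n, X = lin l n) ↔ (∀ x, X.E x x ↔ l) ∧ LinPart l X.E := by
  refine ⟨?_, fun h => ⟨_, eq_lin h.1 h.2⟩⟩
  rintro ⟨n, rfl⟩
  exact ⟨loop_lin l n, linPart_lin l n⟩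

theorem sz_lin (l : Prop) (n : ℕ) : sz l (lin l n).E = n + 1 := by
  rw [lin, sz_mk, sz_linRel]

/-- The inclusion of an initial segment. -/
def linEmb (l : Prop) {m n : ℕ} (h : m ≤ n) : linRel l m ↪r linRel l n :=
  ⟨(Fin.castLEEmb (by omega)), by simp [linRel]⟩

theorem lin_le_lin {l : Prop} {m n : ℕ} : lin l m ≤ lin l n ↔ m ≤ n := by
  refine ⟨fun h => ?_, fun h => mk_le_mk.2 ⟨linEmb l h⟩⟩
  have := sz_le (le_iff.1 h).some l
  rw [sz_lin, sz_lin] at this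
  omega

theorem lin_injective {l : Prop} {m n : ℕ} : lin l m = lin l n ↔ m = n := by
  rw [le_antisymm_iff, lin_le_lin, lin_le_lin, le_antisymm_iff]

theorem le_lin {X : IsoType} {l : Prop} {n : ℕ} : X ≤ lin l n ↔ ∃ m ≤ n, X = lin l m := by
  constructor
  · intro h
    obtain ⟨e⟩ := le_iff.1 h
    obtain ⟨m, rfl⟩ : ∃ m, X = lin l m := exists_eq_lin_iff.2
      ⟨fun x => by rw [← e.map_rel_iff]; exact loop_lin l n _, (linPart_lin l n).of_embedding e⟩
    exact ⟨m, lin_le_lin.1 h, rfl⟩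
  · rintro ⟨m, hm, rfl⟩
    exact lin_le_lin.2 hm

/-! ### Labelled digraphs -/

/-- A digraph `s` whose vertices are joined to initial segments of a linear order. -/
def lbl (l : Prop) (n : ℕ) {W : Type} (s : W → W → Prop) (lab : Bool → W → ℕ) :
    Fin (n + 1) ⊕ W → Fin (n + 1) ⊕ W → Prop
  | .inl i, .inl j => linRel l n i j
  | .inl i, .inr x => i < lab false x
  | .inr x, .inl i => i < lab true x
  | .inr x, .inr y => s x y

/-- The relation or its converse. -/
def dir (b : Bool) {V : Type} (r : V → V → Prop) (x y : V) : Prop := if b then r x y else r y x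

theorem dir_map {V W : Type} {r : V → V → Prop} {s : W → W → Prop} (e : r ↪r s) {b : Bool}
    {x y : V} : dir b s (e x) (e y) ↔ dir b r x y := by
  cases b <;> simp [dir, e.map_rel_iff]

section

variable {l : Prop} {n : ℕ} {W : Type} {s : W → W → Prop} {lab : Bool → W → ℕ}

theorem dir_lbl {b : Bool} {x : W} {i : Fin (n + 1)} :
    dir b (lbl l n s lab) (.inr x) (.inl i) ↔ i < lab b x := by
  cases b <;> simp [dir, lbl]

/-- The linear order in a labelled digraph. -/
def lblLin (l : Prop) (n : ℕ) (s : W → W → Prop) (lab : Bool → W → ℕ) :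
    linRel l n ↪r lbl l n s lab := ⟨⟨Sum.inl, Sum.inl_injective⟩, Iff.rfl⟩

/-- The labelled vertices. -/
def lblIn (l : Prop) (n : ℕ) (s : W → W → Prop) (lab : Bool → W → ℕ) :
    s ↪r lbl l n s lab := ⟨⟨Sum.inr, Sum.inr_injective⟩, Iff.rfl⟩

/-- Labelling is compatible with substructures. -/
def lblMap (l : Prop) (n : ℕ) {W' : Type} {s : W → W → Prop} {s' : W' → W' → Prop}
    (e : s' ↪r s) (lab : Bool → W → ℕ) :
    lbl l n s' (fun b x => lab b (e x)) ↪r lbl l n s lab :=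
  ⟨⟨Sum.map id e, Function.injective_id.sumMap e.injective⟩, by
    rintro (i | x) (j | y) <;> simp [lbl, e.map_rel_iff]⟩

theorem sz_lbl [Finite W] (l l' : Prop) (n : ℕ) (s : W → W → Prop) (lab : Bool → W → ℕ) :
    sz l' (lbl l n s lab) = sz l' (linRel l n) + sz l' s := by
  rw [sz, sz, sz, ← Nat.card_sum]
  exact Nat.card_congr
    ((Equiv.subtypeSum (p := fun x => lbl l n s lab x x ↔ l')).trans (Equiv.refl _))

end

/-- All edges from the vertices not of type `l` to those of type `l` are present. -/
def Full (b : Bool) (l : Prop) {V : Type} (r : V → V → Prop) : Prop :=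
  (∃ x, r x x ↔ ¬l) ∧ ∀ x y, (r x x ↔ ¬l) → (r y y ↔ l) → dir b r x y

theorem Full.iso {b : Bool} {l : Prop} {V W : Type} {r : V → V → Prop} {s : W → W → Prop}
    (e : r ≃r s) (h : Full b l r) : Full b l s := by
  obtain ⟨⟨x, hx⟩, h⟩ := h
  refine ⟨⟨e x, loop_map e.toRelEmbedding hx⟩, fun x y hx hy => ?_⟩
  rw [← dir_map e.symm.toRelEmbedding]
  exact h _ _ (loop_map e.symm.toRelEmbedding hx) (loop_map e.symm.toRelEmbedding hy)

/-- Below `Y` there is a full digraph that contains `T`. -/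
def Ge (b : Bool) (l : Prop) (Y T : IsoType) : Prop := ∃ W, W ≤ Y ∧ T ≤ W ∧ Full b l W.E

/-- The digraph has at most one vertex that is not of type `l`. -/
def AtMostOne (l : Prop) {V : Type} (r : V → V → Prop) : Prop :=
  ∀ x y, (r x x ↔ ¬l) → (r y y ↔ ¬l) → x = y

/-- A full substructure must contain `y₀`, the only vertex not of type `l`, and can keep only points
of the chain among the first `k`, those joined to `y₀`. -/
theorem ge_iff {b : Bool} {l : Prop} {n k m : ℕ} {Y : IsoType} (f : linRel l n ↪r Y.E)
    (hf : ∀ y, (Y.E y y ↔ l) → ∃ i, f i = y) {y₀ : Y.V} (h₀ : Y.E y₀ y₀ ↔ ¬l)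
    (h₁ : AtMostOne l Y.E) (hl : ∀ i, dir b Y.E y₀ (f i) ↔ i < k) (hk : k ≤ n + 1) :
    Ge b l Y (lin l m) ↔ m + 1 ≤ k := by
  constructor
  · rintro ⟨W, hW, hT, ⟨x, hx⟩, hfull⟩
    obtain ⟨g⟩ := le_iff.1 hW
    obtain ⟨h⟩ := mk_le.1 hT
    have hgx : g x = y₀ := h₁ _ _ (loop_map g hx) h₀
    have hj : ∀ j, ∃ i : Fin (n + 1), f i = g (h j) := fun j =>
      hf _ (loop_map g (loop_map h (linRel_self j)))
    choose c hc using hj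
    have hlt : ∀ j, (c j : ℕ) < k := fun j => by
      rw [← hl, hc, ← hgx, dir_map]
      exact hfull _ _ hx (loop_map h (linRel_self j))
    have := Fintype.card_le_of_injective (fun j => (⟨c j, hlt j⟩ : Fin k)) fun a b hab =>
      h.injective (g.injective (by
        rw [← hc, ← hc, Fin.ext (Fin.mk.inj_iff.1 hab)]))
    simpa using this
  · intro hm
    have hne : Nonempty {y | y = y₀ ∨ ∃ i : Fin (n + 1), (i : ℕ) ≤ m ∧ f i = y} := ⟨y₀, .inl rfl⟩
    refine ⟨mk (Subrel Y.E (· ∈ {y | y = y₀ ∨ ∃ i : Fin (n + 1), (i : ℕ) ≤ m ∧ f i = y})),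
      mk_le.2 ⟨Subrel.relEmbedding _ _⟩, ?_, ?_⟩
    · refine mk_le_mk.2 ⟨⟨⟨fun i => ⟨f (i.castLE (by omega)), .inr ⟨_, by simp; omega, rfl⟩⟩, ?_⟩,
        ?_⟩⟩
      · intro i j hij
        simpa using hij
      · intro i j
        exact f.map_rel_iff.trans (linEmb l (by omega : m ≤ n)).map_rel_iff
    · refine Full.iso (mkIso _).symm ⟨⟨⟨y₀, .inl rfl⟩, h₀⟩, ?_⟩
      rintro ⟨x, hx⟩ ⟨y, hy⟩ hx' hy'
      have hx₀ : x = y₀ := h₁ _ _ hx' h₀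
      subst hx₀
      rcases hy with rfl | ⟨i, hi, rfl⟩
      · exact (iff_not_self (hy'.symm.trans h₀)).elim
      · have := (hl i).2 (by omega)
        cases b <;> exact this

/-- `M` and `T` are the linear orders with and without prescribed loops of the same size. -/
def Link (l : Prop) (M T : IsoType) : Prop := ∃ m, M = num m ∧ T = lin l m

/-- The pair of numbers `(A, B)` is the label of a vertex of `R`. -/
def MemL (l : Prop) (R A B : IsoType) : Prop :=
  ∃ Y, Y ≤ R ∧ AtMostOne l Y.E ∧ ∀ M T, Link l M T →
    (T ≤ R → T ≤ Y) ∧ (Ge true l Y T ↔ M ≤ A) ∧ (Ge false l Y T ↔ M ≤ B)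

theorem AtMostOne.iso {l : Prop} {V W : Type} {r : V → V → Prop} {s : W → W → Prop}
    (e : r ≃r s) (h : AtMostOne l r) : AtMostOne l s := fun _ _ hx hy =>
  e.symm.injective (h _ _ (loop_map e.symm.toRelEmbedding hx) (loop_map e.symm.toRelEmbedding hy))

section

variable {l : Prop} {n : ℕ} {W : Type} {s : W → W → Prop} {lab : Bool → W → ℕ}

theorem lbl_type (hs : ∀ x, s x x ↔ ¬l) {z : Fin (n + 1) ⊕ W} :
    (lbl l n s lab z z ↔ l) → ∃ i, z = .inl i := by
  rcases z with i | x
  · exact fun _ => ⟨i, rfl⟩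
  · exact fun h => (iff_not_self (h.symm.trans (hs x))).elim

theorem lbl_type_not {z : Fin (n + 1) ⊕ W} : (lbl l n s lab z z ↔ ¬l) → ∃ x, z = .inr x := by
  rcases z with i | x
  · exact fun h => (iff_not_self ((linRel_self i).symm.trans h)).elim
  · exact fun _ => ⟨x, rfl⟩

/-- Since `Y` still contains the whole chain, `lin_unique` forces `e` to send it identically to the
chain of the labelled digraph, so labels read off in `Y` are the original ones. -/
theorem ge_label {b : Bool} {m : ℕ} {Y : IsoType} (hs : ∀ x, s x x ↔ ¬l)
    (e : Y.E ↪r lbl l n s lab) (f : linRel l n ↪r Y.E) {y₀ : Y.V} {x : W} (hx : e y₀ = .inr x)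
    (h₁ : AtMostOne l Y.E) (hlab : lab b x ≤ n + 1) :
    Ge b l Y (lin l m) ↔ m + 1 ≤ lab b x := by
  have hef : ∀ i, e (f i) = .inl i := fun i => lin_unique (f.trans e) (lblLin l n s lab)
    (fun j => by
      obtain ⟨i, hi⟩ := lbl_type hs (loop_map (f.trans e) (linRel_self j))
      exact ⟨i, hi.symm⟩) i
  refine ge_iff f (fun y hy => ?_) (y₀ := y₀) ?_ h₁ (fun i => ?_) hlab
  · obtain ⟨i, hi⟩ := lbl_type hs (loop_map e hy)
    exact ⟨i, e.injective (by rw [hi, hef])⟩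
  · rw [← e.map_rel_iff, hx]
    exact hs x
  · rw [← dir_map e, hx, hef, dir_lbl]

/-- A witness `Y` consists of the whole chain and one further vertex, whose two labels are measured
by `Ge`. The label `a + 1` codes `a` because `num a` has `a + 1` points. -/
theorem memL_lbl [Finite W] (hs : ∀ x, s x x ↔ ¬l) (hlab : ∀ b x, lab b x ≤ n + 1) {a b : ℕ} :
    MemL l (mk (lbl l n s lab)) (num a) (num b) ↔
      ∃ x, lab true x = a + 1 ∧ lab false x = b + 1 := by
  have hnR : ∀ {Y : IsoType}, (∀ M T, Link l M T → T ≤ mk (lbl l n s lab) → T ≤ Y) →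
      Nonempty (linRel l n ↪r Y.E) := fun h =>
    mk_le.1 (h (num n) (lin l n) ⟨n, rfl, rfl⟩ (mk_le_mk.2 ⟨lblLin l n s lab⟩))
  constructor
  · rintro ⟨Y, hY, h₁, h⟩
    obtain ⟨e⟩ := le_mk.1 hY
    obtain ⟨f⟩ := hnR fun M T hMT => (h M T hMT).1
    -- As `num 0` lies below `num a`, `Ge` holds for the one-point chain and supplies a vertex not
    -- of type `l`.
    obtain ⟨W₀, hW₀, -, ⟨w, hw⟩, -⟩ := (h (num 0) (lin l 0) ⟨0, rfl, rfl⟩).2.1.2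
      (lin_le_lin.2 (Nat.zero_le a))
    obtain ⟨g⟩ := le_iff.1 hW₀
    obtain ⟨x, hx⟩ := lbl_type_not (loop_map e (loop_map g hw))
    refine ⟨x, ?_, ?_⟩
    · have := fun m => (h (num m) (lin l m) ⟨m, rfl, rfl⟩).2.1
      simp only [ge_label hs e f hx h₁ (hlab _ _), lin_le_lin] at this
      have h₁ := this (lab true x - 1)
      have h₂ := this a
      have h₃ := this (lab true x)
      omega
    · have := fun m => (h (num m) (lin l m) ⟨m, rfl, rfl⟩).2.2
      simp only [ge_label hs e f hx h₁ (hlab _ _), lin_le_lin] at this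
      have h₁ := this (lab false x - 1)
      have h₂ := this b
      have h₃ := this (lab false x)
      omega
  · rintro ⟨x, ha, hb⟩
    let u : Subrel s (· = x) ↪r s := Subrel.relEmbedding s _
    let Q := lbl l n (Subrel s (· = x)) fun b y => lab b (u y)
    have h₁ : AtMostOne l (mk Q).E := AtMostOne.iso (mkIso Q).symm fun y z hy hz => by
      obtain ⟨y, rfl⟩ := lbl_type_not hy
      obtain ⟨z, rfl⟩ := lbl_type_not hz
      rw [Subtype.ext (y.2.trans z.2.symm)]
    let f : linRel l n ↪r (mk Q).E := (lblLin l n _ _).trans (mkIso Q).symm.toRelEmbedding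
    let e : (mk Q).E ↪r lbl l n s lab := (mkIso Q).toRelEmbedding.trans (lblMap l n u lab)
    have hx : e ((mkIso Q).symm (.inr ⟨x, rfl⟩)) = .inr x := by
      change lblMap l n u lab (mkIso Q ((mkIso Q).symm _)) = _
      rw [RelIso.apply_symm_apply]
      rfl
    refine ⟨mk Q, mk_le_mk.2 ⟨lblMap l n u lab⟩, h₁, ?_⟩
    rintro - - ⟨m, rfl, rfl⟩
    rw [ge_label hs e f hx h₁ (hlab _ _), ge_label hs e f hx h₁ (hlab _ _), lin_le_lin, lin_le_lin,
      ha, hb]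
    refine ⟨fun h => mk_le.2 ⟨?_⟩, by omega, by omega⟩
    have hm : m ≤ n := by
      have := sz_le (mk_le_mk.1 h).some l
      rw [sz_lbl, sz_linRel, sz_linRel] at this
      have h0 : sz l s = 0 := by simp [sz, hs]
      omega
    exact (linEmb l hm).trans f

end

/-! ### Comparing the number of vertices with a number -/

/-- `X` has more than `M` vertices that are not of type `l`. -/
def SzGt (l : Prop) (X M : IsoType) : Prop :=
  ∃ Z, LinPart l Z.E ∧ (∀ W, (∀ x, W.E x x ↔ ¬l) → W ≤ Z → W ≤ X) ∧ ∀ J, J ≤ M → MemL l Z J J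

theorem sub_type_le (X : IsoType) (l : Prop) [Nonempty {x // X.E x x ↔ l}] :
    mk (Subrel X.E (fun x => X.E x x ↔ l)) ≤ X := mk_le.2 ⟨Subrel.relEmbedding _ _⟩

/-- Here `Z` need not be a labelled digraph. It suffices that the number of out-neighbours of type
`l` recovers `a`, so that different numbers come from different vertices. -/
theorem memL_vertex {l : Prop} {Z : IsoType} (hZ : LinPart l Z.E) {a : ℕ}
    (h : MemL l Z (num a) (num a)) : ∃ z : Z.V, (Z.E z z ↔ ¬l) ∧
      Nat.card {y // (Z.E y y ↔ l) ∧ Z.E z y} = a + 1 := by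
  obtain ⟨Y, hY, h₁, h⟩ := h
  obtain ⟨e⟩ := le_iff.1 hY
  obtain ⟨W₀, hW₀, hT, ⟨w, hw⟩, hfull⟩ := (h (num a) (lin l a) ⟨a, rfl, rfl⟩).2.1.2 le_rfl
  obtain ⟨g⟩ := le_iff.1 hW₀
  obtain ⟨t⟩ := mk_le.1 hT
  have hpos : 0 < sz l Z.E := by
    have := sz_le (t.trans (g.trans e)) l
    rw [sz_linRel] at this
    omega
  obtain ⟨f⟩ := hZ.exists_lin (n := sz l Z.E - 1) (by omega)
  obtain ⟨f'⟩ := mk_le.1 ((h _ _ ⟨sz l Z.E - 1, rfl, rfl⟩).1 (mk_le.2 ⟨f⟩))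
  have hcov : ∀ {y}, (Z.E y y ↔ l) → ∃ i, e (f' i) = y := fun hy =>
    covers (f'.trans e) l (by rw [sz_linRel]; omega) hy
  refine ⟨e (g w), loop_map e (loop_map g hw), le_antisymm ?_ ?_⟩
  -- With more out-neighbours, the vertex and these would form a full substructure containing a
  -- chain of `a + 2` points.
  · by_contra hlt
    have hlt : a + 1 + 1 ≤ Nat.card {y // (Z.E y y ↔ l) ∧ Z.E (e (g w)) y} := by omega
    let P : Y.V → Prop := fun y => y = g w ∨ (Y.E y y ↔ l) ∧ Y.E (g w) y
    have : Nonempty {y // P y} := ⟨g w, .inl rfl⟩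
    have hw' : Y.E (g w) (g w) ↔ ¬l := loop_map g hw
    have hge : Ge true l Y (lin l (a + 1)) := by
      have hr : LinPart l (Subrel Y.E P) := hZ.of_embedding ((Subrel.relEmbedding _ _).trans e)
      refine ⟨mk (Subrel Y.E P), mk_le.2 ⟨Subrel.relEmbedding _ _⟩, ?_, ?_⟩
      · have hsz : a + 1 + 1 ≤ sz l (Subrel Y.E P) := by
          refine hlt.trans ?_
          have hex : ∀ y : {y // (Z.E y y ↔ l) ∧ Z.E (e (g w)) y},
              ∃ x : {x // Subrel Y.E P x x ↔ l},
              e x.1.1 = y.1 := by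
            rintro ⟨y, hy, hy'⟩
            obtain ⟨i, rfl⟩ := hcov hy
            exact ⟨⟨⟨f' i, .inr ⟨loop_map f' (linRel_self i), e.map_rel_iff.1 hy'⟩⟩,
              loop_map f' (linRel_self i)⟩, rfl⟩
          choose c hc using hex
          exact Nat.card_le_card_of_injective c fun x y hxy => Subtype.ext (by
            rw [← hc, ← hc, hxy])
        obtain ⟨q⟩ := hr.exists_lin (n := sz l (Subrel Y.E P) - 1) (by omega)
        exact mk_le_mk.2 ⟨(linEmb l (by omega)).trans q⟩
      · refine Full.iso (mkIso _).symm ⟨⟨⟨g w, .inl rfl⟩, hw'⟩, ?_⟩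
        rintro ⟨x, hx⟩ ⟨y, hy⟩ hx' hy'
        have hx₀ : x = g w := h₁ _ _ hx' hw'
        subst hx₀
        rcases hy with rfl | ⟨-, hy⟩
        · exact (iff_not_self (hy'.symm.trans hw')).elim
        · exact hy
    have := (h (num (a + 1)) _ ⟨a + 1, rfl, rfl⟩).2.1.1 hge
    rw [lin_le_lin] at this
    omega
  · have := Nat.card_le_card_of_injective
      (fun i => (⟨e (g (t i)), loop_map e (loop_map g (loop_map t (linRel_self i))), by
        rw [e.map_rel_iff, g.map_rel_iff]
        exact hfull _ _ hw (loop_map t (linRel_self i))⟩ :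
        {y // (Z.E y y ↔ l) ∧ Z.E (e (g w)) y})) fun i j hij => by
          simpa [Subtype.ext_iff] using hij
    simpa using this

/-- To count, the vertices of `X` not of type `l` are joined to initial segments of lengths `1, 2,
…` of a chain. Conversely, the diagonal entries `0, …, m` need `m + 1` distinct such vertices in
`Z`, and the part of `Z` that they belong to embeds in `X`. -/
theorem szGt_iff {l : Prop} {X : IsoType} {m : ℕ} : SzGt l X (num m) ↔ m < sz (¬l) X.E := by
  constructor
  · rintro ⟨Z, hZ, hW, hJ⟩
    have := fun j : Fin (m + 1) =>
      memL_vertex hZ (hJ (num j) (lin_le_lin.2 (Nat.lt_succ_iff.1 j.2)))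
    choose c hc hc' using this
    have h₁ : m + 1 ≤ sz (¬l) Z.E := by
      have := Nat.card_le_card_of_injective (fun j => (⟨c j, hc j⟩ : {z // Z.E z z ↔ ¬l}))
        fun i j hij => by
          have h := hc' i
          rw [Subtype.mk.inj hij, hc' j] at h
          omega
      rwa [Nat.card_fin] at this
    have : Nonempty {z // Z.E z z ↔ ¬l} := ⟨⟨c 0, hc 0⟩⟩
    obtain ⟨e⟩ := mk_le.1 (hW _ (fun x => by
      rw [← (mkIso _).map_rel_iff]
      exact ((mkIso _) x).2) (sub_type_le Z (¬l)))
    have h₂ := sz_le e (¬l)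
    have h₃ : sz (¬l) (Subrel Z.E fun z => Z.E z z ↔ ¬l) = sz (¬l) Z.E :=
      sz_eq_card fun x => x.2
    omega
  · intro hm
    have hpos : 0 < Nat.card {x // X.E x x ↔ ¬l} := lt_of_le_of_lt (Nat.zero_le _) hm
    have : Nonempty {x // X.E x x ↔ ¬l} := (Nat.card_pos_iff.1 hpos).1
    let s := Subrel X.E (fun x => X.E x x ↔ ¬l)
    have hs : ∀ x, s x x ↔ ¬l := fun x => x.2
    let q := Finite.equivFin {x // X.E x x ↔ ¬l}
    let k := sz (¬l) X.E
    refine ⟨mk (lbl l k s fun _ x => (q x : ℕ) + 1), ?_, ?_, ?_⟩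
    · refine LinPart.of_embedding (mkIso _).toRelEmbedding ?_
      intro x y z hx hy hz hxy
      obtain ⟨x, rfl⟩ := lbl_type hs hx
      obtain ⟨y, rfl⟩ := lbl_type hs hy
      obtain ⟨z, rfl⟩ := lbl_type hs hz
      have := linPart_linRel l k x y z (linRel_self _) (linRel_self _) (linRel_self _)
        fun h => hxy (congrArg _ h)
      exact ⟨this.1, fun hyz => this.2 fun h => hyz (congrArg _ h)⟩
    · intro W hW hle
      obtain ⟨e⟩ := le_mk.1 hle
      have : ∀ w, ∃ x, e w = .inr x := fun w => lbl_type_not (loop_map e (hW w))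
      choose c hc using this
      refine le_iff.2 ⟨⟨⟨fun w => (c w).1, fun x y hxy => ?_⟩, fun {x y} => ?_⟩⟩
      · exact e.injective (by rw [hc, hc, Subtype.ext hxy])
      · rw [← e.map_rel_iff, hc, hc]
        rfl
    · intro J hJ
      obtain ⟨j, hj, rfl⟩ := le_lin.1 hJ
      have hjk : j < k := lt_of_le_of_lt hj hm
      rw [memL_lbl hs (fun _ x => by have : (q x : ℕ) < k := (q x).2; omega)]
      exact ⟨q.symm ⟨j, hjk⟩, by simp⟩

/-! ### Definability of labels, sizes and matching linear orders -/

namespace Def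

variable {α : Type}

theorem loops (l : Prop) (i : α) : Def fun v => ∀ x, (v i).E x x ↔ l :=
  (forall_vertices (fun e _ => e 0 0 ↔ l) i).congr fun _ =>
    ⟨fun h x => h fun _ => x, fun h w => h (w 0)⟩

theorem linPart (l : Prop) (i : α) : Def fun v => LinPart l (v i).E :=
  (forall_vertices (fun e d => (e 0 0 ↔ l) → (e 1 1 ↔ l) → (e 2 2 ↔ l) → ¬d 0 1 →
    (e 0 1 ↔ ¬e 1 0) ∧ (¬d 1 2 → e 0 1 → e 1 2 → e 0 2)) i).congr fun _ =>
    ⟨fun h x y z => h ![x, y, z, x], fun h w => h (w 0) (w 1) (w 2)⟩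

theorem atMostOne (l : Prop) (i : α) : Def fun v => AtMostOne l (v i).E :=
  (forall_vertices (fun e d => (e 0 0 ↔ ¬l) → (e 1 1 ↔ ¬l) → d 0 1) i).congr fun _ =>
    ⟨fun h x y => h ![x, y, x, x], fun h w => h (w 0) (w 1)⟩

theorem full (b : Bool) (l : Prop) (i : α) : Def fun v => Full b l (v i).E :=
  ((forall_vertices (fun e _ => ¬(e 0 0 ↔ ¬l)) i).not.and
    (forall_vertices (fun e _ => (e 0 0 ↔ ¬l) → (e 1 1 ↔ l) → if b then e 0 1 else e 1 0)
      i)).congr fun _ => by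
    refine and_congr ?_ ⟨fun h x y => h ![x, y, x, x], fun h w => h (w 0) (w 1)⟩
    rw [not_forall]
    exact ⟨fun ⟨w, hw⟩ => ⟨w 0, not_not.1 hw⟩, fun ⟨x, hx⟩ => ⟨fun _ => x, not_not.2 hx⟩⟩

theorem num (i : α) : Def fun v => ∃ n, v i = num n :=
  ((loops True i).and (linPart True i)).congr fun _ => exists_eq_lin_iff.symm

theorem ge (b : Bool) (l : Prop) (i j : α) : Def fun v => Ge b l (v i) (v j) :=
  ex (.and (le _ _) (.and (le _ _) (full b l _)))

theorem memL {l : Prop} (hl : ∀ {β : Type} (i j : β), Def fun v => Link l (v i) (v j))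
    (i j k : α) : Def fun v => MemL l (v i) (v j) (v k) :=
  ex (.and (le _ _) (.and (atMostOne l _) (all (all (.imp (hl _ _) (.and (.imp (le _ _) (le _ _))
    (.and (.iff (ge _ _ _ _) (le _ _)) (.iff (ge _ _ _ _) (le _ _)))))))))

theorem szGt {l : Prop} (hl : ∀ {β : Type} (i j : β), Def fun v => Link l (v i) (v j))
    (i j : α) : Def fun v => SzGt l (v i) (v j) :=
  ex (.and (linPart l _) (.and (all (.imp (loops _ _) (.imp (le _ _) (le _ _))))
    (all (.imp (le _ _) (memL hl _ _ _)))))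

theorem link_true (i j : α) : Def fun v => Link True (v i) (v j) :=
  ((num i).and (eq i j)).congr fun v => by
    constructor
    · rintro ⟨⟨n, hn⟩, h⟩
      exact ⟨n, hn, h ▸ hn⟩
    · rintro ⟨n, h₁, h₂⟩
      exact ⟨⟨n, h₁⟩, h₁.trans h₂.symm⟩

/-- A looped and a loopless linear order are never comparable, so their sizes are matched by
counting loopless vertices. This uses `SzGt True`, which rests on `Link True` only, so there is no
circularity. -/
theorem link_false (i j : α) : Def fun v => Link False (v i) (v j) :=
  ((num i).and (((loops False j).and (linPart False j)).and (all (p := fun v J =>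
    (∃ n, J = DigraphOrder.num n) → (SzGt True (v j) J ↔ J ≤ v i))
    (.imp (num _) (.iff (szGt link_true _ _) (le _ _)))))).congr fun v => by
    constructor
    · rintro ⟨⟨m, hm⟩, hT, hs⟩
      obtain ⟨n, hn⟩ := exists_eq_lin_iff.2 hT
      refine ⟨m, hm, ?_⟩
      have h : ∀ j, j < n + 1 ↔ j ≤ m := fun j => by
        have := hs _ ⟨j, rfl⟩
        rw [szGt_iff, hm, hn, lin_le_lin, not_true, sz_lin] at this
        exact this
      have h₁ := h m
      have h₂ := h n
      rw [hn, lin_injective]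
      omega
    · rintro ⟨m, hm, hT⟩
      refine ⟨⟨m, hm⟩, exists_eq_lin_iff.1 ⟨m, hT⟩, ?_⟩
      rintro _ ⟨j, rfl⟩
      rw [szGt_iff, hm, hT, lin_le_lin, not_true, sz_lin, Nat.lt_succ_iff]

theorem link (l : Prop) (i j : α) : Def fun v => Link l (v i) (v j) := by
  by_cases h : l
  · rw [eq_true h]
    exact link_true i j
  · rw [eq_false h]
    exact link_false i j

end Def

/-! ### Codes -/

/-- The finite binary relation coded by `R`. -/
def Mem (R A B : IsoType) : Prop := MemL True R A B

theorem Def.mem {α : Type} (i j k : α) : Def fun v => Mem (v i) (v j) (v k) :=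
  Def.memL (Def.link True) i j k

/-- Each pair in `r` becomes a loopless vertex whose two labels are the coordinates plus one; there
are no edges among these vertices. -/
theorem exists_code (r : ℕ → ℕ → Prop) (N : ℕ) (h : ∀ i j, r i j → i ≤ N ∧ j ≤ N) :
    ∃ S, ∀ i j, Mem S (num i) (num j) ↔ r i j := by
  let W := {p : Fin (N + 1) × Fin (N + 1) // r p.1 p.2}
  let lab : Bool → W → ℕ := fun b x => (if b then (x.1.1 : ℕ) else x.1.2) + 1
  refine ⟨mk (lbl True N (fun _ _ : W => False) lab), fun i j => ?_⟩
  rw [Mem, memL_lbl (by simp) fun b x => by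
    have := x.1.1.2
    have := x.1.2.2
    cases b <;> simp only [lab] <;> simp <;> omega]
  constructor
  · rintro ⟨⟨⟨a, b⟩, hab⟩, h₁, h₂⟩
    simp only [lab, if_true, Bool.false_eq_true, if_false, add_left_inj] at h₁ h₂
    rwa [← h₁, ← h₂]
  · intro hij
    have := h i j hij
    exact ⟨⟨(⟨i, by omega⟩, ⟨j, by omega⟩), hij⟩, rfl, rfl⟩

/-- The digraph on `k + 1` vertices coded by `S`. -/
noncomputable def dec (k : ℕ) (S : IsoType) : FinDigraph :=
  ⟨k, ⟨fun i j => Mem S (num i) (num j)⟩⟩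

theorem exists_code_fin {m n : ℕ} (r : Fin (m + 1) → Fin (n + 1) → Prop) :
    ∃ S, ∀ (i : Fin (m + 1)) (j : Fin (n + 1)), Mem S (num i) (num j) ↔ r i j := by
  obtain ⟨S, hS⟩ := exists_code
    (fun i j => ∃ (hi : i < m + 1) (hj : j < n + 1), r ⟨i, hi⟩ ⟨j, hj⟩) (m + n)
    fun i j ⟨hi, hj, _⟩ => ⟨by omega, by omega⟩
  exact ⟨S, fun i j => (hS i j).trans ⟨fun ⟨_, _, h⟩ => h, fun h => ⟨i.2, j.2, h⟩⟩⟩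

theorem exists_dec (G : FinDigraph) : ∃ S, dec G.n S = G := by
  obtain ⟨n, ⟨r⟩⟩ := G
  obtain ⟨S, hS⟩ := exists_code_fin r
  refine ⟨S, ?_⟩
  simp only [dec, hS]

theorem exists_of_dec (X : IsoType) : ∃ n S, X = of (dec n S) := by
  obtain ⟨S, hS⟩ := exists_dec (Quotient.out X)
  exact ⟨_, S, by rw [hS, of_out]⟩

theorem le_num_iff {X : IsoType} {k : ℕ} : X ≤ num k ↔ ∃ i : Fin (k + 1), X = num i := by
  rw [le_lin]
  exact ⟨fun ⟨m, hm, h⟩ => ⟨⟨m, by omega⟩, h⟩, fun ⟨i, h⟩ => ⟨i, by omega, h⟩⟩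

theorem forall_le_num {k : ℕ} {p : IsoType → Prop} :
    (∀ X, X ≤ num k → p X) ↔ ∀ i : Fin (k + 1), p (num i) := by
  simp only [le_num_iff]
  exact ⟨fun h i => h _ ⟨i, rfl⟩, by rintro h _ ⟨i, rfl⟩; exact h i⟩

theorem exists_le_num {k : ℕ} {p : IsoType → Prop} :
    (∃ X, X ≤ num k ∧ p X) ↔ ∃ i : Fin (k + 1), p (num i) := by
  simp only [le_num_iff]
  exact ⟨fun ⟨_, ⟨i, rfl⟩, h⟩ => ⟨i, h⟩, fun ⟨i, h⟩ => ⟨_, ⟨i, rfl⟩, h⟩⟩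

theorem num_inj {k : ℕ} {i j : Fin (k + 1)} : num i = num j ↔ i = j := by
  rw [lin_injective, Fin.val_inj]

/-- Embeddability of coded digraphs. -/
def EmbCode (K S K' S' : IsoType) : Prop :=
  ∃ F, (∀ i, i ≤ K → ∃ j, j ≤ K' ∧ Mem F i j) ∧ ∀ i, i ≤ K → ∀ j, j ≤ K' → ∀ i', i' ≤ K →
    ∀ j', j' ≤ K' → Mem F i j → Mem F i' j' → ((i = i' ↔ j = j') ∧ (Mem S i i' ↔ Mem S' j j'))

/-- In `EmbCode`, the equivalence `i = i' ↔ j = j'` makes `F` single-valued and injective at once.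
-/
theorem embCode_iff {k k' : ℕ} {S S' : IsoType} :
    EmbCode (num k) S (num k') S' ↔ of (dec k S) ≤ of (dec k' S') := by
  simp only [EmbCode, forall_le_num, exists_le_num, num_inj, of_le_of]
  constructor
  · rintro ⟨F, h₁, h₂⟩
    choose f hf using h₁
    exact ⟨⟨⟨f, fun i i' h => (h₂ _ _ _ _ (hf i) (hf i')).1.2 h⟩,
      fun {i i'} => (h₂ _ _ _ _ (hf i) (hf i')).2.symm⟩⟩
  · rintro ⟨f⟩
    obtain ⟨F, hF⟩ := exists_code_fin (m := k) (n := k') fun i j => f i = j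
    refine ⟨F, fun i => ⟨f i, (hF _ _).2 rfl⟩, fun i j i' j' h h' => ?_⟩
    obtain rfl := (hF _ _).1 h
    obtain rfl := (hF _ _).1 h'
    exact ⟨f.injective.eq_iff.symm, f.map_rel_iff.symm⟩

theorem Def.embCode {α : Type} (i j k m : α) : Def fun v => EmbCode (v i) (v j) (v k) (v m) :=
  .ex (.and (.all (.imp (.le _ _) (.ex (.and (.le _ _) (.mem _ _ _)))))
    (.all (.imp (.le _ _) (.all (.imp (.le _ _) (.all (.imp (.le _ _) (.all (.imp (.le _ _)
    (.imp (.mem _ _ _) (.imp (.mem _ _ _) (.and (.iff (.eq _ _) (.eq _ _))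
    (.iff (.mem _ _ _) (.mem _ _ _))))))))))))))

/-- `Has` for coded digraphs. -/
def HasCode (t : (Fin 4 → Fin 4 → Prop) × (Fin 4 → Fin 4 → Prop)) (K S : IsoType) : Prop :=
  ∃ w : Fin 4 → IsoType, (∀ a, w a ≤ K) ∧
    ∀ a b, (Mem S (w a) (w b) ↔ t.1 a b) ∧ (w a = w b ↔ t.2 a b)

theorem hasCode_iff {t} {k : ℕ} {S : IsoType} : HasCode t (num k) S ↔ Has t (dec k S).E := by
  constructor
  · rintro ⟨w, h₁, h₂⟩
    simp only [le_num_iff] at h₁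
    choose u hu using h₁
    refine ⟨u, fun a b => ?_⟩
    have := h₂ a b
    rwa [hu, hu, num_inj] at this
  · rintro ⟨u, h⟩
    exact ⟨fun a => num (u a), fun a => le_num_iff.2 ⟨_, rfl⟩, fun a b => ⟨(h a b).1,
      num_inj.trans (h a b).2⟩⟩

theorem Def.hasCode {α : Type} (t) (i j : α) : Def fun v => HasCode t (v i) (v j) :=
  .exs (.and (.forall_fin fun _ => .le _ _) (.forall_fin fun _ => .forall_fin fun _ =>
    .and (.iff (.mem _ _ _) (.const _)) (.iff (.eq _ _) (.const _))))

/-- `SzGt` for coded digraphs. -/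
def SzCode (l : Prop) (K S M : IsoType) : Prop :=
  ∃ F, ∀ j, j ≤ M → ∃ i, i ≤ K ∧ (Mem S i i ↔ ¬l) ∧ Mem F j i ∧ ∀ j', j' ≤ M → Mem F j' i → j' = j

/-- `F` assigns to each `j ≤ m` a vertex not of type `l` that determines `j`, which amounts to an
injection. -/
theorem szCode_iff {l : Prop} {k m : ℕ} {S : IsoType} :
    SzCode l (num k) S (num m) ↔ m < sz (¬l) (dec k S).E := by
  simp only [SzCode, forall_le_num, exists_le_num, num_inj]
  constructor
  · rintro ⟨F, h⟩
    choose f h₁ h₂ h₃ using h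
    have := Nat.card_le_card_of_injective
      (fun j => (⟨f j, h₁ j⟩ : {x : (dec k S).V // (dec k S).E x x ↔ ¬l})) fun i j hij =>
        h₃ _ _ (by rw [← Subtype.mk.inj hij]; exact h₂ i)
    rwa [Nat.card_fin] at this
  · intro h
    let q := Finite.equivFin {x : (dec k S).V // (dec k S).E x x ↔ ¬l}
    let f : Fin (m + 1) → {x : (dec k S).V // (dec k S).E x x ↔ ¬l} :=
      fun j => q.symm (j.castLE h)
    have hf : Function.Injective f := fun i j hij =>
      Fin.castLE_injective h (q.symm.injective hij)
    obtain ⟨F, hF⟩ := exists_code_fin (m := m) (n := k) fun j i => (f j).1 = i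
    refine ⟨F, fun j => ⟨(f j).1, (f j).2, (hF j (f j).1).2 rfl, fun j' hj' => ?_⟩⟩
    exact hf (Subtype.ext ((hF j' (f j).1).1 hj'))

theorem Def.szCode {α : Type} (l : Prop) (i j k : α) :
    Def fun v => SzCode l (v i) (v j) (v k) :=
  .ex (.all (.imp (.le _ _) (.ex (.and (.le _ _) (.and (.iff (.mem _ _ _) (.const _))
    (.and (.mem _ _ _) (.all (.imp (.le _ _) (.imp (.mem _ _ _) (.eq _ _))))))))))

/-! ### Digraphs determined by their profile -/

/-- `X` and `Y` look alike: they have the same small substructures, the same numbers of vertices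
with and without loops, and the same position with respect to the elements of `N`. -/
def Prof (N : Set IsoType) (X Y : IsoType) : Prop :=
  (∀ t, Has t X.E ↔ Has t Y.E) ∧ (∀ l, sz l X.E = sz l Y.E) ∧
    ∀ Z ∈ N, (X ≤ Z ↔ Y ≤ Z) ∧ (Z ≤ X ↔ Z ≤ Y)

/-- The digraphs that are determined by how they look like. -/
def det (N : Set IsoType) : Set IsoType := {X | ∀ Y, Prof N X Y → X = Y}

theorem subset_det (N : Set IsoType) : N ⊆ det N := fun X hX _ h =>
  le_antisymm ((h.2.2 X hX).2.1 le_rfl) ((h.2.2 X hX).1.1 le_rfl)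

/-- `X` is an element of `N` with the code `(K, S)`. -/
def Code (N : Set IsoType) (X K S : IsoType) : Prop :=
  ∃ n, K = num n ∧ X ∈ N ∧ X = of (dec n S)

/-- The elements of `N` can be decoded. -/
def Coded (N : Set IsoType) : Prop :=
  ∀ {α : Type} (i j k : α), Def fun v => Code N (v i) (v j) (v k)

theorem Coded.mem {N : Set IsoType} (h : Coded N) {α : Type} (i : α) : Def fun v => v i ∈ N :=
  (Def.ex (p := fun v K => ∃ S, Code N (v i) K S) (Def.ex (h _ _ _))).congr fun v => by
    constructor
    · rintro ⟨K, S, n, -, hN, -⟩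
      exact hN
    · intro hN
      obtain ⟨n, S, hS⟩ := exists_of_dec (v i)
      exact ⟨num n, S, n, rfl, hN, hS⟩

theorem sz_eq_iff {V W : Type} {r : V → V → Prop} {s : W → W → Prop} :
    (∀ l, sz l r = sz l s) ↔ ∀ l, ∀ m, m < sz (¬l) r ↔ m < sz (¬l) s := by
  constructor
  · intro h l m
    rw [h]
  · intro h l
    have := h (¬l)
    rw [not_not] at this
    exact le_antisymm (not_lt.1 fun h' => lt_irrefl _ ((this _).1 h'))
      (not_lt.1 fun h' => lt_irrefl _ ((this _).2 h'))

/-- Every ingredient of a profile is expressible for `X` and also for the code: patterns by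
`HasCode`, sizes by `SzCode`, the position relative to a decodable element of `N` by `EmbCode`. If
they agree, the decoded digraph looks like `X` and therefore equals it. -/
theorem Coded.det {N : Set IsoType} (h : Coded N) : Coded (det N) := by
  intro α i j k
  have hdet : ∀ {β : Type} (i : β), Def fun v => v i ∈ DigraphOrder.det N := fun i =>
    (Def.all (p := fun v Y => (∀ t, Has t (v i).E ↔ Has t Y.E) ∧
      (∀ l, ∀ M, (∃ n, M = num n) → (SzGt l (v i) M ↔ SzGt l Y M)) ∧
      (∀ Z, Z ∈ N → (v i ≤ Z ↔ Y ≤ Z) ∧ (Z ≤ v i ↔ Z ≤ Y)) → v i = Y)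
      (.imp (.and (.forall_fin fun t => .iff (.has t _) (.has t _))
        (.and (.forall_fin fun l => .all (.imp (.num _) (.iff (.szGt (.link l) _ _)
          (.szGt (.link l) _ _)))) (.all (.imp (h.mem _) (.and (.iff (.le _ _) (.le _ _))
          (.iff (.le _ _) (.le _ _))))))) (.eq _ _))).congr fun v => by
      refine forall_congr' fun Y => imp_congr_left
        (and_congr_right fun _ => and_congr_left fun _ => ?_)
      rw [sz_eq_iff]
      refine forall_congr' fun l => ⟨fun h m => ?_, ?_⟩
      · have := h _ ⟨m, rfl⟩
        rwa [szGt_iff, szGt_iff] at this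
      · rintro h _ ⟨m, rfl⟩
        rw [szGt_iff, szGt_iff]
        exact h m
  have hmain : Def fun v : α → IsoType => (∃ n, v j = num n) ∧ v i ∈ DigraphOrder.det N ∧
      (∀ t, Has t (v i).E ↔ HasCode t (v j) (v k)) ∧
      (∀ l, ∀ M, (∃ n, M = num n) → (SzGt l (v i) M ↔ SzCode l (v j) (v k) M)) ∧
      (∀ Z K S, Code N Z K S → ((v i ≤ Z ↔ EmbCode (v j) (v k) K S) ∧
        (Z ≤ v i ↔ EmbCode K S (v j) (v k)))) :=
    .and (.num _) (.and (hdet _) (.and (.forall_fin fun t => .iff (.has t _) (.hasCode t _ _))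
      (.and (.forall_fin fun l => .all (.imp (.num _) (.iff (.szGt (.link l) _ _)
        (.szCode l _ _ _)))) (.all (.all (.all (.imp (h _ _ _) (.and
          (.iff (.le _ _) (.embCode _ _ _ _)) (.iff (.le _ _) (.embCode _ _ _ _))))))))))
  refine hmain.congr fun v => ?_
  constructor
  · rintro ⟨⟨n, hn⟩, hX, ht, hs, hN⟩
    refine ⟨n, hn, hX, hX _ ⟨fun t => ?_, ?_, fun Z hZ => ?_⟩⟩
    · rw [ht, hn, hasCode_iff]
      exact (has_iso (nonempty_of_iso _).some).symm
    · refine sz_eq_iff.2 fun l m => ?_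
      rw [← szGt_iff, hs l _ ⟨m, rfl⟩, hn, szCode_iff, sz_iso (nonempty_of_iso (dec n (v k))).some]
    · obtain ⟨m, S, hS⟩ := exists_of_dec Z
      have := hN Z (num m) S ⟨m, rfl, hZ, hS⟩
      rw [hn, embCode_iff, embCode_iff, ← hS] at this
      exact this
  · rintro ⟨n, hn, hX, hXn⟩
    have e := (nonempty_of_iso (dec n (v k))).some
    rw [← hXn] at e
    refine ⟨⟨n, hn⟩, hX, fun t => ?_, ?_, ?_⟩
    · rw [hn, hasCode_iff]
      exact has_iso e
    · rintro l _ ⟨m, rfl⟩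
      rw [szGt_iff, hn, szCode_iff, sz_iso e]
    · rintro Z K S ⟨m, rfl, -, hZ⟩
      rw [hn, embCode_iff, embCode_iff, ← hZ, ← hXn]
      exact ⟨Iff.rfl, Iff.rfl⟩

/-- The set of all linear orders. -/
def linears : Set IsoType := {X | ∃ l n, X = lin l n}

theorem eq_of_dec_iff {l : Prop} {n : ℕ} {S : IsoType} :
    (∃ m, of (dec n S) = lin l m) ↔ (∀ x, (dec n S).E x x ↔ l) ∧ LinPart l (dec n S).E := by
  have e := (nonempty_of_iso (dec n S)).some
  rw [exists_eq_lin_iff]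
  refine and_congr ⟨fun h x => ?_, fun h x => ?_⟩
    ⟨.of_embedding e.symm.toRelEmbedding, .of_embedding e.toRelEmbedding⟩
  · rw [← e.symm.map_rel_iff]
    exact h _
  · rw [← e.map_rel_iff]
    exact h _

/-- If every pattern of the decoded digraph occurs in the linear order, it inherits the universal
conditions that define linear orders of that loop type; its `n + 1` vertices then identify it. -/
theorem coded_linears : Coded linears := by
  intro α i j k
  have hmain : Def fun v : α → IsoType => ∃ l, Link l (v j) (v i) ∧
      ∀ t, HasCode t (v j) (v k) → Has t (v i).E :=
    .exists_fin fun l => .and (.link l _ _)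
      (.forall_fin fun t => .imp (.hasCode t _ _) (.has t _))
  refine hmain.congr fun v => ?_
  constructor
  · rintro ⟨l, ⟨n, hj, hi⟩, ht⟩
    simp only [hj, hasCode_iff] at ht
    replace ht : ∀ t, Has t (dec n (v k)).E → Has t (lin l n).E := hi ▸ ht
    refine ⟨n, hj, ⟨l, n, hi⟩, ?_⟩
    have key : ∀ w : Fin 4 → (dec n (v k)).V, ∃ w' : Fin 4 → (lin l n).V,
        ∀ a b, ((lin l n).E (w' a) (w' b) ↔ (dec n (v k)).E (w a) (w b)) ∧
          (w' a = w' b ↔ w a = w b) := fun w =>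
      ht (fun a b => (dec n (v k)).E (w a) (w b), fun a b => w a = w b)
        ⟨w, fun a b => ⟨Iff.rfl, Iff.rfl⟩⟩
    have hloop : ∀ x, (dec n (v k)).E x x ↔ l := fun x => by
      obtain ⟨w', hw'⟩ := key fun _ => x
      rw [← (hw' 0 0).1]
      exact loop_lin l n _
    obtain ⟨m, hm⟩ := (eq_of_dec_iff (l := l)).2 ⟨hloop, fun x y z _ _ _ hxy => by
      obtain ⟨w', hw'⟩ := key ![x, y, z, x]
      have := linPart_lin l n (w' 0) (w' 1) (w' 2) (loop_lin _ _ _) (loop_lin _ _ _)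
        (loop_lin _ _ _) fun h => hxy ((hw' 0 1).2.1 h)
      rw [(hw' 0 1).1, (hw' 1 0).1, (hw' 1 2).1, (hw' 0 2).1, ne_eq, (hw' 1 2).2] at this
      exact this⟩
    have hs := sz_lin l m
    rw [← hm, sz_iso (nonempty_of_iso (dec n (v k))).some, sz_eq_card hloop] at hs
    have hc : Nat.card (dec n (v k)).V = n + 1 := Nat.card_fin _
    rw [hi, hm, lin_injective]
    omega
  · rintro ⟨n, hj, ⟨l, m, hi⟩, hX⟩
    have e := (nonempty_of_iso (dec n (v k))).some
    rw [← hX] at e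
    refine ⟨l, ⟨n, hj, ?_⟩, fun t ht => ?_⟩
    · have hs := sz_lin l m
      rw [← hi, sz_iso e, sz_eq_card ((eq_of_dec_iff.1 ⟨m, hX ▸ hi⟩).1)] at hs
      have hc : Nat.card (dec n (v k)).V = n + 1 := Nat.card_fin _
      rw [hi, lin_injective]
      omega
    · rw [hj, hasCode_iff] at ht
      exact (has_iso e).2 ht

/-! ### Consequences of looking alike -/

namespace Prof

variable {N : Set IsoType} {V : Type} [Finite V] [Nonempty V] {r : V → V → Prop} {Y : IsoType}

theorem sz_eq (h : Prof N (mk r) Y) (l : Prop) : sz l Y.E = sz l r := by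
  rw [← h.2.1 l, sz_mk]

/-- Looking alike fixes the number of vertices, so a single embedding, here or in the opposite
direction, is an isomorphism. -/
theorem eq_of_embedding (h : Prof N (mk r) Y) (e : r ↪r Y.E) : mk r = Y :=
  eq_of_le_of_sz (mk_le.2 ⟨e⟩) fun l => (h.2.1 l).ge

theorem eq_of_embedding' (h : Prof N (mk r) Y) (e : Y.E ↪r r) : mk r = Y :=
  (eq_of_le_of_sz (le_mk.2 ⟨e⟩) fun l => (h.2.1 l).le).symm

theorem types (h : Prof N (mk r) Y) (w : Fin 4 → V) : ∃ w' : Fin 4 → Y.V,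
    ∀ a b, (Y.E (w' a) (w' b) ↔ r (w a) (w b)) ∧ (w' a = w' b ↔ w a = w b) :=
  (h.1 (fun a b => r (w a) (w b), fun a b => w a = w b)).1
    ((has_mk r).2 ⟨w, fun _ _ => ⟨Iff.rfl, Iff.rfl⟩⟩)

theorem types' (h : Prof N (mk r) Y) (w : Fin 4 → Y.V) : ∃ w' : Fin 4 → V,
    ∀ a b, (r (w' a) (w' b) ↔ Y.E (w a) (w b)) ∧ (w' a = w' b ↔ w a = w b) :=
  (has_mk r).1 ((h.1 (fun a b => Y.E (w a) (w b), fun a b => w a = w b)).2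
    ⟨w, fun _ _ => ⟨Iff.rfl, Iff.rfl⟩⟩)

variable {W : Type} [Finite W] [Nonempty W] {q : W → W → Prop}

theorem embedding (h : Prof N (mk r) Y) (hq : mk q ∈ N) (e : q ↪r r) : Nonempty (q ↪r Y.E) :=
  mk_le.1 ((h.2.2 _ hq).2.1 (mk_le_mk.2 ⟨e⟩))

theorem embedding_iff (h : Prof N (mk r) Y) (hq : mk q ∈ N) :
    Nonempty (q ↪r r) ↔ Nonempty (q ↪r Y.E) := by
  rw [← mk_le, ← mk_le_mk]
  exact (h.2.2 _ hq).2

theorem embedding' (h : Prof N (mk r) Y) (hq : mk q ∈ N) (e : r ↪r q) : Nonempty (Y.E ↪r q) :=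
  le_mk.1 ((h.2.2 _ hq).1.1 (mk_le_mk.2 ⟨e⟩))

theorem linear (h : Prof N (mk r) Y) (hN : linears ⊆ N) {l : Prop} {n : ℕ} (e : linRel l n ↪r r) :
    Nonempty (linRel l n ↪r Y.E) := h.embedding (hN ⟨l, n, rfl⟩) e

end Prof

/-! ### Labels -/

/-- The vertex `y` is joined, in both directions, to the first `p` points of a linear order, and to
no others. -/
def Lab {V : Type} (r : V → V → Prop) {n : ℕ} (f : Fin (n + 1) → V) (y : V) (p : ℕ) : Prop :=
  ∀ i, (r y (f i) ↔ (i : ℕ) < p) ∧ (r (f i) y ↔ (i : ℕ) < p)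

theorem Lab.unique {V : Type} {r : V → V → Prop} {n : ℕ} {f : Fin (n + 1) → V} {y : V} {p q : ℕ}
    (hp : Lab r f y p) (hq : Lab r f y q) (hpn : p ≤ n + 1) (hqn : q ≤ n + 1) : p = q := by
  by_contra hne
  rcases lt_or_gt_of_ne hne with h | h
  · have := (hp ⟨p, by omega⟩).1.symm.trans (hq ⟨p, by omega⟩).1
    simp only at this
    omega
  · have := (hp ⟨q, by omega⟩).1.symm.trans (hq ⟨q, by omega⟩).1
    simp only at this
    omega

theorem Lab.congr {V : Type} {r : V → V → Prop} {n : ℕ} {f g : Fin (n + 1) → V} {y : V} {p : ℕ}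
    (h : Lab r f y p) (hfg : ∀ i, f i = g i) : Lab r g y p := fun i => by
  rw [← hfg]
  exact h i

theorem lab_lbl {l : Prop} {n : ℕ} {W V : Type} {s : W → W → Prop} {p : W → ℕ} {r : V → V → Prop}
    (e : lbl l n s (fun _ => p) ↪r r) (x : W) :
    Lab r (fun i => e (.inl i)) (e (.inr x)) (p x) := fun _ =>
  ⟨e.map_rel_iff, e.map_rel_iff⟩

/-- Recognizing a labelled digraph. -/
def lblBuild {l : Prop} {n : ℕ} {W V : Type} {s : W → W → Prop} {p : W → ℕ} {r : V → V → Prop}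
    (f : linRel l n ↪r r) (y : W → V) (hy : Function.Injective y) (hfy : ∀ i x, f i ≠ y x)
    (hlab : ∀ x, Lab r f (y x) (p x)) (hs : ∀ x x', r (y x) (y x') ↔ s x x') :
    lbl l n s (fun _ => p) ↪r r :=
  ⟨⟨Sum.elim f y, f.injective.sumElim hy hfy⟩, by
    rintro (i | x) (j | x')
    · exact f.map_rel_iff
    · exact (hlab x' i).2
    · exact (hlab x j).1
    · exact hs x x'⟩

/-- One vertex not of type `l`, joined to the first `p` points of a linear order. -/
def point (l : Prop) (n p : ℕ) : Fin (n + 1) ⊕ Unit → Fin (n + 1) ⊕ Unit → Prop :=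
  lbl l n (fun _ _ : Unit => ¬l) (fun _ _ => p)

theorem ne_of_type {V : Type} {r : V → V → Prop} {l : Prop} {x y : V} (hx : r x x ↔ l)
    (hy : r y y ↔ ¬l) : x ≠ y := by
  rintro rfl
  exact iff_not_self (hx.symm.trans hy)

/-- The points joined to their whole chain are rulers that measure the label of an arbitrary point.
-/
theorem point_embedding {l : Prop} {i n k : ℕ} (hk : k ≤ n + 1) :
    Nonempty (point l i (i + 1) ↪r point l n k) ↔ i + 1 ≤ k := by
  constructor
  · rintro ⟨e⟩
    obtain ⟨x, hx⟩ := lbl_type_not (loop_map e (x := .inr ()) (l := ¬l) Iff.rfl)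
    have hj : ∀ j : Fin (i + 1), ∃ c : Fin (n + 1), e (.inl j) = .inl c := fun j =>
      lbl_type (fun _ => Iff.rfl) (loop_map e (x := .inl j) (linRel_self j))
    choose c hc using hj
    have hlt : ∀ j, (c j : ℕ) < k := fun j => by
      have : point l n k (e (.inr ())) (e (.inl j)) := e.map_rel_iff.2 j.2
      rw [hx, hc] at this
      exact this
    have := Fintype.card_le_of_injective (fun j => (⟨c j, hlt j⟩ : Fin k)) fun a b hab =>
      Sum.inl_injective (e.injective (by
        rw [hc, hc, Fin.ext (Fin.mk.inj_iff.1 hab)]))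
    simpa using this
  · intro h
    refine ⟨lblBuild ((linEmb l (by omega : i ≤ n)).trans (lblLin l n _ _)) (fun _ => .inr ())
      (fun _ _ _ => rfl) (fun _ _ => Sum.inl_ne_inr) (fun _ j => ?_) fun _ _ => Iff.rfl⟩
    have hj : (j : ℕ) < i + 1 := j.2
    have hjk : (j : ℕ) < k := by omega
    exact ⟨⟨fun _ => hj, fun _ => hjk⟩, ⟨fun _ => hj, fun _ => hjk⟩⟩

theorem exists_of_sz_pos {V : Type} {r : V → V → Prop} {l : Prop} (h : 0 < sz l r) :
    ∃ x, r x x ↔ l := by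
  obtain ⟨⟨x, hx⟩⟩ := (Nat.card_pos_iff.1 h).1
  exact ⟨x, hx⟩

theorem initial_segment {n : ℕ} {S : Fin (n + 1) → Prop} (hS : ∀ i j, i < j → S j → S i) :
    ∃ k ≤ n + 1, ∀ i : Fin (n + 1), S i ↔ (i : ℕ) < k := by
  classical
  by_cases h : ∃ k, ∃ hk : k < n + 1, ¬S ⟨k, hk⟩
  · obtain ⟨hk, hS'⟩ := Nat.find_spec h
    refine ⟨Nat.find h, hk.le, fun i => ⟨fun hi => ?_, fun hi => ?_⟩⟩
    · by_contra hlt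
      rcases (not_lt.1 hlt).lt_or_eq with h' | h'
      · exact hS' (hS _ i h' hi)
      · exact hS' (by convert hi)
    · by_contra hi'
      exact Nat.find_min h hi ⟨i.2, hi'⟩
  · push Not at h
    exact ⟨n + 1, le_rfl, fun i => ⟨fun _ => i.2, fun _ => h i i.2⟩⟩

section

variable {N : Set IsoType} (hN : linears ⊆ N)

include hN

/-- That the extra vertex is joined in both directions to every chain point is a condition on two
vertices, and patterns transfer it to `Y`. -/
theorem full_point_mem_det (l : Prop) (i : ℕ) : mk (point l i (i + 1)) ∈ det N := by
  intro Y h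
  obtain ⟨f⟩ := h.linear hN (lblLin l i _ _)
  have hs : sz (¬l) Y.E = 1 := by
    rw [h.sz_eq, point, sz_lbl, sz_not_linRel]
    simp [sz]
  obtain ⟨y, hy⟩ := exists_of_sz_pos (hs ▸ Nat.one_pos)
  refine h.eq_of_embedding (lblBuild f (fun _ => y) (fun _ _ _ => rfl)
    (fun j _ => ne_of_type (loop_map f (linRel_self j)) hy) (fun _ j => ?_) fun _ _ => hy)
  obtain ⟨w, hw⟩ := h.types' ![y, f j, y, y]
  obtain ⟨a, ha⟩ := lbl_type_not ((hw 0 0).1.trans hy)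
  obtain ⟨b, hb⟩ := lbl_type (fun _ => Iff.rfl) ((hw 1 1).1.trans (loop_map f (linRel_self j)))
  have h₁ := (hw 0 1).1
  have h₂ := (hw 1 0).1
  rw [ha, hb] at h₁ h₂
  have hbi : (b : ℕ) < i + 1 := b.2
  have hji : (j : ℕ) < i + 1 := j.2
  exact ⟨⟨fun _ => hji, fun _ => h₁.1 hbi⟩, ⟨fun _ => hji, fun _ => h₂.1 hbi⟩⟩

/-- Conditions on three vertices make the edges of the extra vertex symmetric and its neighbourhood
an initial segment. So `Y` is a point with some label `k`, and the rulers that embed in it give `k =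
p`. -/
theorem point_mem_det (hV : ∀ l i, mk (point l i (i + 1)) ∈ N) (l : Prop) {n p : ℕ}
    (hp : p ≤ n + 1) : mk (point l n p) ∈ det N := by
  intro Y h
  obtain ⟨f⟩ := h.linear hN (lblLin l n _ _)
  have hs : sz (¬l) Y.E = 1 := by
    rw [h.sz_eq, point, sz_lbl, sz_not_linRel]
    simp [sz]
  obtain ⟨y, hy⟩ := exists_of_sz_pos (hs ▸ Nat.one_pos)
  have key : ∀ j j', (Y.E y (f j) ↔ Y.E (f j) y) ∧ (j' < j → Y.E y (f j) → Y.E y (f j')) := by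
    intro j j'
    obtain ⟨w, hw⟩ := h.types' ![y, f j, f j', y]
    obtain ⟨a, ha⟩ := lbl_type_not ((hw 0 0).1.trans hy)
    obtain ⟨b, hb⟩ := lbl_type (fun _ => Iff.rfl) ((hw 1 1).1.trans (loop_map f (linRel_self j)))
    obtain ⟨c, hc⟩ := lbl_type (fun _ => Iff.rfl) ((hw 2 2).1.trans (loop_map f (linRel_self j')))
    have h₁ := (hw 0 1).1
    have h₂ := (hw 1 0).1
    have h₃ := (hw 0 2).1
    have h₄ := (hw 2 1).1
    rw [ha, hb] at h₁ h₂
    rw [ha, hc] at h₃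
    rw [hb, hc] at h₄
    refine ⟨h₁.symm.trans h₂, fun hlt he => h₃.1 ?_⟩
    have hbp : (b : ℕ) < p := h₁.2 he
    have hcb : linRel l n c b := h₄.2 (f.map_rel_iff.2 (.inl hlt))
    have hcb' : c ≤ b := by
      rcases hcb with hcb | hcb
      · exact hcb.le
      · exact hcb.1.le
    have hcp : (c : ℕ) < p := lt_of_le_of_lt hcb' hbp
    exact hcp
  obtain ⟨k, hk, hk'⟩ := initial_segment (S := fun j => Y.E y (f j)) fun i j => (key j i).2
  have e : point l n k ↪r Y.E := lblBuild f (fun _ => y) (fun _ _ _ => rfl)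
    (fun j _ => ne_of_type (loop_map f (linRel_self j)) hy)
    (fun _ j => ⟨hk' j, (key j j).1.symm.trans (hk' j)⟩) fun _ _ => hy
  have hsz : ∀ l', sz l' (point l n k) = sz l' Y.E := fun l' => by
    rw [h.sz_eq, point, point, sz_lbl, sz_lbl]
  have e' : point l n k ≃r Y.E :=
    RelIso.ofSurjective e (surjective_of_sz e l (hsz _).ge (hsz _).ge)
  have hkp : ∀ i, i + 1 ≤ p ↔ i + 1 ≤ k := fun i => by
    rw [← point_embedding hp, ← point_embedding hk, h.embedding_iff (hV l i)]
    exact ⟨fun ⟨g⟩ => ⟨g.trans e'.symm.toRelEmbedding⟩, fun ⟨g⟩ => ⟨g.trans e⟩⟩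
  have : p = k := by
    have h₁ := hkp (p - 1)
    have h₂ := hkp (k - 1)
    omega
  subst this
  exact h.eq_of_embedding e

end

/-- The embedding of one labelled vertex. -/
def pointEmb {l : Prop} {n : ℕ} {W : Type} {s : W → W → Prop} {p : W → ℕ} {x : W}
    (hx : s x x ↔ ¬l) : point l n (p x) ↪r lbl l n s (fun _ => p) :=
  lblBuild (lblLin l n _ _) (fun _ => .inr x) (fun _ _ _ => rfl) (fun _ _ => Sum.inl_ne_inr)
    (fun _ _ => ⟨Iff.rfl, Iff.rfl⟩) fun _ _ => hx

section

variable {N : Set IsoType} {l : Prop} {n : ℕ} {W : Type} [Finite W] {s : W → W → Prop} {p : W → ℕ}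
  {Y : IsoType}

/-- A digraph that looks like a labelled one consists of a linear order and labelled vertices. -/
theorem exists_skeleton (hN : linears ⊆ N) (hP : ∀ p ≤ n + 1, mk (point l n p) ∈ N)
    (hs : ∀ x, s x x ↔ ¬l) (hp : Function.Injective p) (hpn : ∀ x, p x ≤ n + 1)
    (h : Prof N (mk (lbl l n s fun _ => p)) Y) :
    ∃ (f : linRel l n ↪r Y.E) (y : W → Y.V), (∀ z, (Y.E z z ↔ l) → ∃ i, f i = z) ∧
      (∀ z, (Y.E z z ↔ ¬l) → ∃ x, y x = z) ∧ (∀ x, Y.E (y x) (y x) ↔ ¬l) ∧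
      (∀ x, Lab Y.E f (y x) (p x)) ∧ Function.Injective y := by
  obtain ⟨f⟩ := h.linear hN (lblLin l n _ _)
  have h₀ : sz l s = 0 := by simp [sz, hs]
  have h₁ : sz (¬l) s = Nat.card W := sz_eq_card hs
  have hf : ∀ z, (Y.E z z ↔ l) → ∃ i, f i = z := fun z hz => covers f l (by
    rw [h.sz_eq, sz_lbl, h₀, add_zero]) hz
  -- A labelled vertex with its chain embeds in `Y`, and that chain must be `f`, since `f` covers
  -- all vertices of type `l`.
  have hx : ∀ x, ∃ y, (Y.E y y ↔ ¬l) ∧ Lab Y.E f y (p x) := fun x => by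
    obtain ⟨e⟩ := h.embedding (hP _ (hpn x)) (pointEmb (hs x))
    refine ⟨e (.inr ()), loop_map e (x := .inr ()) (l := ¬l) Iff.rfl, ?_⟩
    have hef : ∀ i, ((lblLin l n _ _).trans e) i = f i := lin_unique _ f fun i =>
      hf _ (loop_map ((lblLin l n _ _).trans e) (linRel_self i))
    exact (lab_lbl e ()).congr hef
  choose y hy hlab using hx
  have hinj : Function.Injective y := fun x x' hxx =>
    hp ((hlab x).unique (hxx ▸ hlab x') (hpn x) (hpn x'))
  refine ⟨f, y, hf, fun z hz => ?_, hy, hlab, hinj⟩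
  obtain ⟨x, hx⟩ := surjective_of_card
    (f := fun x => (⟨y x, hy x⟩ : {z // Y.E z z ↔ ¬l}))
    (fun x x' hxx => hinj (Subtype.mk.inj hxx)) (by
      have := h.sz_eq (¬l)
      rw [sz_lbl, sz_not_linRel, h₁, zero_add] at this
      exact this.le) ⟨z, hz⟩
  exact ⟨x, Subtype.mk.inj hx⟩

end

/-- Only the edges between the two labelled vertices are open. A pattern exhibits them together with
the chain point in position `p false`, which is joined to the vertex with the larger label only and
so tells the two apart. -/
theorem pair_mem_det {N : Set IsoType} {l : Prop} {n : ℕ} {s : Bool → Bool → Prop} {p : Bool → ℕ}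
    (hN : linears ⊆ N) (hP : ∀ p ≤ n + 1, mk (point l n p) ∈ N) (hs : ∀ x, s x x ↔ ¬l)
    (hp : p false < p true) (hpn : p true ≤ n + 1) : mk (lbl l n s fun _ => p) ∈ det N := by
  intro Y h
  have hinj : Function.Injective p := by
    rintro (_ | _) (_ | _) hxy
    · rfl
    · omega
    · omega
    · rfl
  obtain ⟨f, y, hf, hy, hty, hlab, hyi⟩ := exists_skeleton hN hP hs hinj
    (by rintro (_ | _) <;> omega) h
  obtain ⟨w, hw⟩ := h.types ![.inr false, .inr true, .inl ⟨p false, by omega⟩, .inr true]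
  obtain ⟨a, ha⟩ := hy (w 0) ((hw 0 0).1.trans (hs false))
  obtain ⟨b, hb⟩ := hy (w 1) ((hw 1 1).1.trans (hs true))
  obtain ⟨i, hi⟩ := hf (w 2) ((hw 2 2).1.trans (linRel_self _))
  have h₁ : a ≠ b := by
    rintro rfl
    exact Sum.inr_injective.ne (by decide) ((hw 0 1).2.1 (ha.symm.trans hb))
  have h₂ : ¬Y.E (w 0) (w 2) := fun he => by
    have : p false < p false := (hw 0 2).1.1 he
    omega
  have h₃ : Y.E (w 1) (w 2) := (hw 1 2).1.2 hp
  rw [← ha, ← hi, (hlab a i).1] at h₂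
  rw [← hb, ← hi, (hlab b i).1] at h₃
  have h₄ : a = false ∧ b = true := by
    rcases a with _ | _ <;> rcases b with _ | _
    · exact (h₁ rfl).elim
    · exact ⟨rfl, rfl⟩
    · omega
    · exact (h₁ rfl).elim
  obtain ⟨rfl, rfl⟩ := h₄
  refine h.eq_of_embedding (lblBuild f y hyi
    (fun i x => ne_of_type (loop_map f (linRel_self i)) (hty x)) hlab ?_)
  rintro (_ | _) (_ | _)
  · exact (hty false).trans (hs false).symm
  · rw [ha, hb]
    exact (hw 0 1).1
  · rw [ha, hb]
    exact (hw 1 0).1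
  · exact (hty true).trans (hs true).symm

/-- The pair of two vertices. -/
def pick {W : Type} (x x' : W) (b : Bool) : W := if b then x' else x

/-- The embedding of a pair of labelled vertices. -/
def pairEmb {W : Type} {x x' : W} (hx : x ≠ x') (s : W → W → Prop) :
    (fun b c => s (pick x x' b) (pick x x' c)) ↪r s :=
  ⟨⟨pick x x', by rintro (_ | _) (_ | _) h <;> simp_all [pick]⟩, Iff.rfl⟩

/-- Every labelled pair embeds in `Y`, and as labels are distinct they show which vertices of `Y` it
hits; so all edges are determined two vertices at a time. -/
theorem opposite_mem_det {N : Set IsoType} {l : Prop} {n : ℕ} {W : Type} [Finite W]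
    {s : W → W → Prop} {p : W → ℕ} (hN : linears ⊆ N) (hP : ∀ p ≤ n + 1, mk (point l n p) ∈ N)
    (hF : ∀ (s : Bool → Bool → Prop) (p : Bool → ℕ), (∀ x, s x x ↔ ¬l) → p false < p true →
      p true ≤ n + 1 → mk (lbl l n s fun _ => p) ∈ N)
    (hs : ∀ x, s x x ↔ ¬l) (hp : Function.Injective p) (hpn : ∀ x, p x ≤ n + 1) :
    mk (lbl l n s fun _ => p) ∈ det N := by
  intro Y h
  obtain ⟨f, y, hf, hy, hty, hlab, hyi⟩ := exists_skeleton hN hP hs hp hpn h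
  refine h.eq_of_embedding (lblBuild f y hyi
    (fun i x => ne_of_type (loop_map f (linRel_self i)) (hty x)) hlab ?_)
  have key : ∀ x x', p x < p x' → (Y.E (y x) (y x') ↔ s x x') ∧ (Y.E (y x') (y x) ↔ s x' x) := by
    intro x x' hlt
    have hne : x ≠ x' := fun hxx => hlt.ne (congrArg p hxx)
    obtain ⟨e⟩ := h.embedding (hF _ (fun b => p (pick x x' b)) (fun b => hs _) hlt (hpn x'))
      (lblMap l n (pairEmb hne s) fun _ => p)
    have hef : ∀ i, ((lblLin l n _ _).trans e) i = f i := lin_unique _ f fun i =>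
      hf _ (loop_map ((lblLin l n _ _).trans e) (linRel_self i))
    have hy' : ∀ b, e (.inr b) = y (pick x x' b) := fun b => by
      obtain ⟨z, hz⟩ := hy _ (loop_map e (x := .inr b) (hs (pick x x' b)))
      have hl := (lab_lbl e b).congr hef
      rw [← hz] at hl
      rw [← hz, hp ((hlab z).unique hl (hpn _) (hpn _))]
    have h₁ := e.map_rel_iff (a := .inr false) (b := .inr true)
    have h₂ := e.map_rel_iff (a := .inr true) (b := .inr false)
    rw [hy', hy'] at h₁ h₂
    exact ⟨h₁, h₂⟩
  intro x x'
  rcases lt_trichotomy (p x) (p x') with hlt | heq | hlt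
  · exact (key x x' hlt).1
  · rw [hp heq, hty, hs]
  · exact (key x' x hlt).2

theorem exists_labels (V : Type) [Finite V] :
    ∃ p : V → ℕ, Function.Injective p ∧ ∀ x, 1 ≤ p x ∧ p x ≤ Nat.card V := by
  let q := Finite.equivFin V
  refine ⟨fun x => q x + 1, fun x x' h => q.injective (Fin.ext (by simpa using h)), fun x => ?_⟩
  have : (q x : ℕ) < Nat.card V := (q x).2
  simp only
  omega

/-- `Y` embeds in a labelled version of `r`, and having no vertex of type `l` it avoids the chain.
-/
theorem pure_mem_det {N : Set IsoType} {l : Prop} {V : Type} [Finite V] [Nonempty V]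
    {r : V → V → Prop} (hZ : ∀ n (p : V → ℕ), Function.Injective p → (∀ x, p x ≤ n + 1) →
      mk (lbl l n r fun _ => p) ∈ N) (hr : ∀ x, r x x ↔ ¬l) : mk r ∈ det N := by
  intro Y h
  obtain ⟨p, hp, hpn⟩ := exists_labels V
  obtain ⟨e⟩ := h.embedding' (hZ (Nat.card V) p hp fun x => by have := hpn x; omega)
    (lblIn l _ _ _)
  have hY : ∀ y, Y.E y y ↔ ¬l := fun y => by
    by_contra hy
    have : Nonempty {y // Y.E y y ↔ l} := ⟨⟨y, by tauto⟩⟩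
    have hpos : 0 < sz l Y.E := Nat.card_pos
    rw [h.sz_eq] at hpos
    obtain ⟨x, hx⟩ := exists_of_sz_pos hpos
    exact ne_of_type hx (hr x) rfl
  have hc : ∀ y, ∃ x, e y = .inr x := fun y => lbl_type_not (loop_map e (hY y))
  choose c hc using hc
  refine h.eq_of_embedding' ⟨⟨c, fun a b hab => e.injective (by rw [hc, hc, hab])⟩, fun {a b} => ?_⟩
  rw [← e.map_rel_iff, hc, hc]
  rfl

/-! ### Labelled digraphs in general -/

/-- Distinct chain points are joined in exactly one direction, a chain point and a labelled vertex
in both or neither. Hence a copy of the chain lies within the chain or within `W`, and `W` is too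
small. -/
theorem linRel_lbl_unique {l : Prop} {n : ℕ} {W : Type} [Finite W] {s : W → W → Prop} {p : W → ℕ}
    (hn : Nat.card W ≤ n) (k : linRel l n ↪r lbl l n s fun _ => p) (i : Fin (n + 1)) :
    k i = .inl i := by
  have hall : ∀ i, ∃ j, k i = .inl j := by
    intro i
    by_contra hi
    have hi : ∃ x, k i = .inr x := by
      rcases hki : k i with j | x
      · exact (hi ⟨j, hki⟩).elim
      · exact ⟨x, rfl⟩
    obtain ⟨x, hx⟩ := hi
    have hj : ∀ j, ∃ x, k j = .inr x := by
      intro j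
      by_cases hij : j = i
      · exact ⟨x, hij ▸ hx⟩
      · have h₁ := k.map_rel_iff (a := i) (b := j)
        have h₂ := k.map_rel_iff (a := j) (b := i)
        rw [linRel_of_ne (Ne.symm hij), hx] at h₁
        rw [linRel_of_ne hij, hx] at h₂
        rcases hkj : k j with m | x'
        · rw [hkj] at h₁ h₂
          have h₃ : i < j ↔ j < i := h₁.symm.trans h₂
          omega
        · exact ⟨x', rfl⟩
    choose c hc using hj
    have := Nat.card_le_card_of_injective c fun a b hab => k.injective (by rw [hc, hc, hab])
    rw [Nat.card_fin] at this
    omega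
  exact lin_unique k (lblLin l n _ _) (fun i => (hall i).imp fun _ h => h.symm) i

section

variable {N : Set IsoType} {l : Prop} {n : ℕ} {W : Type} [Finite W] {s : W → W → Prop} {p : W → ℕ}
  {Y : IsoType}

/-- A digraph that looks like a labelled one may only differ from it in the edges between labelled
vertices of different types. -/
theorem exists_mixed_skeleton
    (hpure : ∀ {V : Type} [Finite V] [Nonempty V] (r : V → V → Prop), (∀ x, r x x ↔ l) → mk r ∈ N)
    (hZ : ∀ {V : Type} [Finite V] (r : V → V → Prop) (p : V → ℕ), (∀ x, r x x ↔ ¬l) →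
      Function.Injective p → (∀ x, p x ≤ n + 1) → mk (lbl l n r fun _ => p) ∈ N)
    (hp : Function.Injective p) (hpn : ∀ x, p x ≤ n + 1) (hn : Nat.card W ≤ n)
    (h : Prof N (mk (lbl l n s fun _ => p)) Y) :
    ∃ (f : linRel l n ↪r Y.E) (y : W → Y.V), (∀ k : linRel l n ↪r Y.E, ∀ i, k i = f i) ∧
      (∀ z, (∃ i, f i = z) ∨ ∃ x, y x = z) ∧ (∀ i x, f i ≠ y x) ∧
      (∀ x, Lab Y.E f (y x) (p x)) ∧ Function.Injective y ∧
      ∀ l' x x', (s x x ↔ l') → (s x' x' ↔ l') → (Y.E (y x) (y x') ↔ s x x') := by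
  -- The chain with the labelled vertices of type `l` is all of one type; the chain with the others
  -- is covered by `hZ`. Both embed in `Y`, by counting they cover it, and their chains coincide.
  let u := Subrel.relEmbedding s (fun x => s x x ↔ l)
  let v := Subrel.relEmbedding s (fun x => s x x ↔ ¬l)
  obtain ⟨g⟩ := h.embedding (hpure _ (by
    rintro (i | x)
    · exact linRel_self i
    · exact x.2)) (lblMap l n u fun _ => p)
  obtain ⟨k⟩ := h.embedding (hZ _ (fun x => p (v x)) (fun x => x.2) (hp.comp v.injective)
    fun x => hpn _) (lblMap l n v fun _ => p)
  have hul : sz l (Subrel s fun x => s x x ↔ l) = sz l s := sz_eq_card fun x => x.2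
  have hvl : sz (¬l) (Subrel s fun x => s x x ↔ ¬l) = sz (¬l) s := sz_eq_card fun x => x.2
  have hg : ∀ z, (Y.E z z ↔ l) → ∃ a, g a = z := fun z hz => covers g l (by
    rw [h.sz_eq, sz_lbl, sz_lbl, hul]) hz
  have hk : ∀ z, (Y.E z z ↔ ¬l) → ∃ a, k a = z := fun z hz => covers k (¬l) (by
    rw [h.sz_eq, sz_lbl, sz_lbl, hvl]) hz
  have huniq : ∀ e : linRel l n ↪r Y.E, ∀ i, e i = g (.inl i) := by
    intro e
    have : ∀ i, ∃ a, g a = e i := fun i => hg _ (loop_map e (linRel_self i))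
    choose c hc using this
    let e' : linRel l n ↪r _ := ⟨⟨c, fun a b hab => e.injective (by rw [← hc, ← hc, hab])⟩,
      fun {a b} => by
        rw [← e.map_rel_iff, ← hc, ← hc, g.map_rel_iff]
        rfl⟩
    intro i
    rw [← hc]
    exact congrArg g (linRel_lbl_unique
      ((Nat.card_le_card_of_injective _ Subtype.val_injective).trans hn) e' i)
  have hkg : ∀ i, k (.inl i) = g (.inl i) := huniq ((lblLin l n _ _).trans k)
  have hx : ∀ x, ∃ y, ((∃ h, y = g (.inr ⟨x, h⟩)) ∨ ∃ h, y = k (.inr ⟨x, h⟩)) := fun x => by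
    rcases iff_or_iff_not (s x x) l with hx | hx
    · exact ⟨_, .inl ⟨hx, rfl⟩⟩
    · exact ⟨_, .inr ⟨hx, rfl⟩⟩
  choose y hy using hx
  have hyg : ∀ x (hx : s x x ↔ l), y x = g (.inr ⟨x, hx⟩) := fun x hx => by
    rcases hy x with ⟨_, h'⟩ | ⟨h', _⟩
    · exact h'
    · exact (ne_of_type hx h' rfl).elim
  have hyk : ∀ x (hx : s x x ↔ ¬l), y x = k (.inr ⟨x, hx⟩) := fun x hx => by
    rcases hy x with ⟨h', _⟩ | ⟨_, h'⟩
    · exact (ne_of_type h' hx rfl).elim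
    · exact h'
  have hfy : ∀ i x, g (.inl i) ≠ y x := fun i x => by
    rcases iff_or_iff_not (s x x) l with hx | hx
    · rw [hyg x hx]
      exact g.injective.ne Sum.inl_ne_inr
    · rw [hyk x hx, ← hkg]
      exact k.injective.ne Sum.inl_ne_inr
  have hlab : ∀ x, Lab Y.E (fun i => g (.inl i)) (y x) (p x) := fun x => by
    rcases iff_or_iff_not (s x x) l with hx | hx
    · rw [hyg x hx]
      exact lab_lbl g ⟨x, hx⟩
    · rw [hyk x hx]
      have := lab_lbl k ⟨x, hx⟩
      simp only [hkg] at this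
      exact this
  refine ⟨(lblLin l n _ _).trans g, y, huniq, fun z => ?_, hfy, hlab, fun x x' hxx => ?_, ?_⟩
  · rcases iff_or_iff_not (Y.E z z) l with hz | hz
    · obtain ⟨i | ⟨x, hx⟩, ha⟩ := hg z hz
      · exact .inl ⟨i, ha⟩
      · exact .inr ⟨x, (hyg x hx).trans ha⟩
    · obtain ⟨i | ⟨x, hx⟩, ha⟩ := hk z hz
      · exact .inl ⟨i, (hkg i).symm.trans ha⟩
      · exact .inr ⟨x, (hyk x hx).trans ha⟩
  · exact hp ((hlab x).unique (hxx ▸ hlab x') (hpn x) (hpn x'))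
  · intro l' x x' hx hx'
    rcases iff_or_iff_not l' l with hl | hl <;> rw [hl] at hx hx'
    · rw [hyg x hx, hyg x' hx', g.map_rel_iff]
      rfl
    · rw [hyk x hx, hyk x' hx', k.map_rel_iff]
      rfl

/-- `hF` places each labelled pair of mixed loop types, with its chain, inside `Y`; the labels
identify the pair and yield the edges left open by the skeleton. -/
theorem mixed_mem_det
    (hpure : ∀ {V : Type} [Finite V] [Nonempty V] (r : V → V → Prop), (∀ x, r x x ↔ l) → mk r ∈ N)
    (hZ : ∀ {V : Type} [Finite V] (r : V → V → Prop) (p : V → ℕ), (∀ x, r x x ↔ ¬l) →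
      Function.Injective p → (∀ x, p x ≤ n + 1) → mk (lbl l n r fun _ => p) ∈ N)
    (hp : Function.Injective p) (hpn : ∀ x, p x ≤ n + 1) (hn : Nat.card W ≤ n)
    (hF : ∀ x x', (s x x ↔ ¬l) → (s x' x' ↔ l) → ∀ Y,
      Prof N (mk (lbl l n s fun _ => p)) Y →
      Nonempty (lbl l n (fun b c => s (pick x x' b) (pick x x' c))
        (fun _ b => p (pick x x' b)) ↪r Y.E)) :
    mk (lbl l n s fun _ => p) ∈ det N := by
  intro Y h
  obtain ⟨f, y, hf, hy, hfy, hlab, hyi, hE⟩ := exists_mixed_skeleton hpure hZ hp hpn hn h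
  refine h.eq_of_embedding (lblBuild f y hyi hfy hlab ?_)
  have key : ∀ x x', (s x x ↔ ¬l) → (s x' x' ↔ l) →
      (Y.E (y x) (y x') ↔ s x x') ∧ (Y.E (y x') (y x) ↔ s x' x) := by
    intro x x' hx hx'
    obtain ⟨e⟩ := hF x x' hx hx' Y h
    have hef : ∀ i, e (.inl i) = f i := hf ((lblLin l n _ _).trans e)
    have hy' : ∀ b, e (.inr b) = y (pick x x' b) := fun b => by
      rcases hy (e (.inr b)) with ⟨i, hi⟩ | ⟨z, hz⟩
      · rw [← hef] at hi
        exact (Sum.inl_ne_inr (e.injective hi)).elim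
      · have hl := lab_lbl e b
        rw [show (fun i => e (.inl i)) = f from funext hef, ← hz] at hl
        rw [← hz, hp ((hlab z).unique hl (hpn _) (hpn _))]
    have h₁ := e.map_rel_iff (a := .inr false) (b := .inr true)
    have h₂ := e.map_rel_iff (a := .inr true) (b := .inr false)
    rw [hy', hy'] at h₁ h₂
    exact ⟨h₁, h₂⟩
  intro x x'
  rcases iff_or_iff_not (s x x) l with hx | hx <;> rcases iff_or_iff_not (s x' x') l with hx' | hx'
  · exact hE l x x' hx hx'
  · exact (key x' x hx' hx).2
  · exact (key x x' hx hx').1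
  · exact hE _ x x' hx hx'

end

/-- Here patterns need four vertices: the pair and two chain points. If the image of the labelled
vertex of type `l` lay on the chain of `Y`, the images of both chain points, related symmetrically
to it, would be off the chain, where only one vertex of type `l` is available. -/
theorem mixed_pair_mem_det {N : Set IsoType} {l : Prop} {n : ℕ} {s : Bool → Bool → Prop}
    {p : Bool → ℕ}
    (hpure : ∀ {V : Type} [Finite V] [Nonempty V] (r : V → V → Prop), (∀ x, r x x ↔ l) → mk r ∈ N)
    (hZ : ∀ {V : Type} [Finite V] (r : V → V → Prop) (p : V → ℕ), (∀ x, r x x ↔ ¬l) →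
      Function.Injective p → (∀ x, p x ≤ n + 1) → mk (lbl l n r fun _ => p) ∈ N)
    (hp : Function.Injective p) (hpn : ∀ x, p x ≤ n + 1) (hn : 2 ≤ n)
    (hs : s false false ↔ ¬l) (hs' : s true true ↔ l) : mk (lbl l n s fun _ => p) ∈ det N := by
  intro Y h
  obtain ⟨f, y, hf, hy, hfy, hlab, hyi, hE⟩ :=
    exists_mixed_skeleton hpure hZ hp hpn (by simpa using hn) h
  refine h.eq_of_embedding (lblBuild f y hyi hfy hlab ?_)
  have h₀ : Y.E (y false) (y false) ↔ ¬l := (hE _ _ _ hs hs).trans hs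
  have h₁ : Y.E (y true) (y true) ↔ l := (hE _ _ _ hs' hs').trans hs'
  obtain ⟨w, hw⟩ := h.types ![.inr false, .inr true, .inl ⟨0, by omega⟩, .inl ⟨1, by omega⟩]
  have hw₀ : w 0 = y false := by
    have ht : Y.E (w 0) (w 0) ↔ ¬l := (hw 0 0).1.trans hs
    rcases hy (w 0) with ⟨i, hi⟩ | ⟨b, hb⟩
    · exact (ne_of_type (loop_map f (linRel_self i)) (hi ▸ ht) rfl).elim
    · rcases b with _ | _
      · exact hb.symm
      · exact (ne_of_type h₁ (hb ▸ ht) rfl).elim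
  have htrue : ∀ z, (Y.E z z ↔ l) → (∀ i, f i ≠ z) → z = y true := fun z hz hz' => by
    rcases hy z with ⟨i, hi⟩ | ⟨b, hb⟩
    · exact (hz' i hi).elim
    · rcases b with _ | _
      · subst hb
        exact (ne_of_type hz h₀ rfl).elim
      · exact hb.symm
  have hw₁ : w 1 = y true := by
    refine htrue _ ((hw 1 1).1.trans hs') fun i hi => ?_
    have aux : ∀ z, z ≠ w 1 → (Y.E (w 1) z ↔ Y.E z (w 1)) → ∀ j, f j ≠ z := by
      rintro _ hz hz' j rfl
      rw [← hi, f.map_rel_iff, f.map_rel_iff] at hz'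
      have hij : i ≠ j := fun hij => hz (by rw [← hi, hij])
      rw [linRel_of_ne hij, linRel_of_ne hij.symm] at hz'
      omega
    have h₂ : w 2 = y true := htrue _ ((hw 2 2).1.trans (linRel_self _))
      (aux _ (fun he => Sum.inl_ne_inr ((hw 2 1).2.1 he)) ((hw 1 2).1.trans (hw 2 1).1.symm))
    have h₃ : w 3 = y true := htrue _ ((hw 3 3).1.trans (linRel_self _))
      (aux _ (fun he => Sum.inl_ne_inr ((hw 3 1).2.1 he)) ((hw 1 3).1.trans (hw 3 1).1.symm))
    have := (hw 2 3).2.1 (h₂.trans h₃.symm)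
    simp at this
  rintro (_ | _) (_ | _)
  · exact hE _ _ _ hs hs
  · rw [← hw₀, ← hw₁]
    exact (hw 0 1).1
  · rw [← hw₀, ← hw₁]
    exact (hw 1 0).1
  · exact hE _ _ _ hs' hs'

/-! ### Adding a vertex -/

/-- Add a vertex `none` not of type `l`, with an edge to all vertices of type `l`, and joined in
both directions to all other vertices if `t`. -/
def addVertex (l t : Prop) {V : Type} (r : V → V → Prop) : Option V → Option V → Prop
  | none, none => ¬l
  | none, some x => (r x x ↔ l) ∨ t
  | some x, none => (r x x ↔ ¬l) ∧ t
  | some x, some y => r x y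

/-- The vertex is joined in both directions to all others not of type `l`, or to none of them. -/
def Dom (l t : Prop) {V : Type} (r : V → V → Prop) (x : V) : Prop :=
  ∀ y, (r y y ↔ ¬l) → y ≠ x → (r x y ↔ t) ∧ (r y x ↔ t)

/-- The inclusion into the digraph with an added vertex. -/
def addVertexEmb (l t : Prop) {V : Type} (r : V → V → Prop) : r ↪r addVertex l t r :=
  ⟨⟨some, Option.some_injective V⟩, Iff.rfl⟩

section

variable {N : Set IsoType} {l t : Prop} {V : Type} {r : V → V → Prop} {Y : IsoType}

theorem addVertex_none {x : V} (hx : r x x ↔ ¬l) :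
    (addVertex l t r none (some x) ↔ t) ∧ (addVertex l t r (some x) none ↔ t) := by
  simp only [addVertex]
  tauto

theorem addVertex_none' {x : V} (hx : r x x ↔ l) :
    addVertex l t r none (some x) ∧ ¬addVertex l t r (some x) none := by
  simp only [addVertex]
  tauto

theorem dom_of_embedding {n : ℕ} {lab : Bool → Option V → ℕ}
    (e : Y.E ↪r lbl l n (addVertex l t r) lab)
    {a : Y.V} (ha : e a = .inr none) : Dom l t Y.E a := by
  intro y hy hya
  obtain ⟨_ | x, hx⟩ := lbl_type_not (loop_map e hy)
  · exact (hya (e.injective (hx.trans ha.symm))).elim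
  · have h := loop_map e hy
    rw [← e.map_rel_iff, ← e.map_rel_iff (a := y), ha, hx]
    rw [hx] at h
    exact addVertex_none h

/-- Since `e` covers all vertices not of type `l`, a second vertex with `Dom` in `Y` would give one
in `r`. -/
theorem eq_of_dom [Finite V] {n : ℕ} {lab : Bool → Option V → ℕ}
    (hr : ∀ x, (r x x ↔ ¬l) → ¬Dom l t r x)
    (e : Y.E ↪r lbl l n (addVertex l t r) lab)
    (hc : sz (¬l) (lbl l n (addVertex l t r) lab) ≤ sz (¬l) Y.E) {a b : Y.V} (ha : e a = .inr none)
    (hb : Y.E b b ↔ ¬l) (hd : Dom l t Y.E b) : b = a := by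
  obtain ⟨_ | x, hx⟩ := lbl_type_not (loop_map e hb)
  · exact e.injective (hx.trans ha.symm)
  · have h := loop_map e hb
    rw [hx] at h
    refine (hr x h fun x' hx' hne => ?_).elim
    obtain ⟨y, hy⟩ := covers e (¬l) hc (y := .inr (some x')) hx'
    have hy' : Y.E y y ↔ ¬l := by
      rw [← e.map_rel_iff, hy]
      exact hx'
    have := hd y hy' (fun hyb => hne (by
      rw [hyb, hx] at hy
      exact (Option.some_injective _ (Sum.inr_injective hy)).symm))
    rw [← e.map_rel_iff, ← e.map_rel_iff (a := y), hx, hy] at this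
    exact this

/-- The added vertex is the only one with `Dom`. `Y` embeds in two labelled digraphs, where this
vertex has label `0` and label `n + 1`. A vertex sent to the chain by the first embedding would
receive no edge from it, while the second shows such an edge to every vertex of type `l`. So the
first embedding avoids the chain. -/
theorem addVertex_mem_det [Finite V]
    (hG : ∀ {W : Type} [Finite W] (n : ℕ) (s : W → W → Prop) (p : W → ℕ), Function.Injective p →
      (∀ x, p x ≤ n + 1) → Nat.card W ≤ n → 2 ≤ n → mk (lbl l n s fun _ => p) ∈ N)
    (hr : ∀ x, (r x x ↔ ¬l) → ¬Dom l t r x) : mk (addVertex l t r) ∈ det N := by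
  intro Y h
  obtain ⟨p, hp, hpn⟩ := exists_labels V
  -- Large enough for `2 ≤ n` and `Nat.card (Option V) ≤ n`; both `0` and `n + 1` differ from all
  -- values of `p`.
  let n := Nat.card V + 2
  let q : ℕ → Option V → ℕ := fun c x => x.elim c p
  have hcard : Nat.card (Option V) ≤ n := by
    rw [Finite.card_option]
    omega
  have hq : ∀ c, c = 0 ∨ c = n + 1 → Nonempty (Y.E ↪r lbl l n (addVertex l t r) fun _ => q c) := by
    intro c hc
    refine h.embedding' (hG n _ (q c) ?_ ?_ hcard (by omega)) (lblIn l _ _ _)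
    · rintro (_ | x) (_ | y) hxy
      · rfl
      · have := hpn y
        simp only [q, Option.elim] at hxy
        omega
      · have := hpn x
        simp only [q, Option.elim] at hxy
        omega
      · rw [hp hxy]
    · rintro (_ | x)
      · simp only [q, Option.elim]
        omega
      · have := hpn x
        simp only [q, Option.elim]
        omega
  obtain ⟨e⟩ := hq 0 (.inl rfl)
  obtain ⟨e'⟩ := hq (n + 1) (.inr rfl)
  have hsz : ∀ lab, sz (¬l) (lbl l n (addVertex l t r) lab) ≤ sz (¬l) Y.E := fun lab => by
    rw [sz_lbl, sz_not_linRel, h.sz_eq, zero_add]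
  obtain ⟨a, ha⟩ := covers e (¬l) (hsz _) (y := .inr none) Iff.rfl
  obtain ⟨b, hb⟩ := covers e' (¬l) (hsz _) (y := .inr none) Iff.rfl
  have hbt : Y.E b b ↔ ¬l := by
    rw [← e'.map_rel_iff, hb]
    exact Iff.rfl
  obtain rfl := eq_of_dom hr e (hsz _) ha hbt (dom_of_embedding e' hb)
  have hc : ∀ y, ∃ x, e y = .inr x := by
    intro y
    rcases hy : e y with i | x
    · have hyt : Y.E y y ↔ l := by
        rw [← e.map_rel_iff, hy]
        exact linRel_self i
      have h₁ : ¬Y.E b y := by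
        rw [← e.map_rel_iff, ha, hy]
        exact Nat.not_lt_zero _
      refine (h₁ ?_).elim
      rw [← e'.map_rel_iff, hb]
      have ht := loop_map e' hyt
      rcases hy' : e' y with j | _ | x
      · exact j.2
      · rw [hy'] at ht
        exact (ne_of_type (r := addVertex l t r) (x := none) ht Iff.rfl rfl).elim
      · rw [hy'] at ht
        exact (addVertex_none' ht).1
    · exact ⟨x, rfl⟩
  choose c hc using hc
  refine h.eq_of_embedding' ⟨⟨c, fun a b hab => e.injective (by rw [hc, hc, hab])⟩, fun {a b} => ?_⟩
  rw [← e.map_rel_iff, hc, hc]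
  rfl

/-- Among at least two vertices, one joined to all others and one joined to none cannot coexist, nor
coincide. -/
theorem exists_no_dom [Finite V] (hr : 2 ≤ sz (¬l) r) : ∃ t, ∀ x, (r x x ↔ ¬l) → ¬Dom l t r x := by
  by_contra! h
  obtain ⟨x, hx, hxd⟩ := h True
  obtain ⟨y, hy, hyd⟩ := h False
  by_cases hxy : y = x
  · subst hxy
    have : Nontrivial {x // r x x ↔ ¬l} := Finite.one_lt_card_iff_nontrivial.1 hr
    obtain ⟨⟨z, hz⟩, hne⟩ := exists_ne (⟨y, hy⟩ : {x // r x x ↔ ¬l})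
    have hne : z ≠ y := fun h => hne (Subtype.ext h)
    exact ((hyd z hz hne).1.1 ((hxd z hz hne).1.2 trivial))
  · exact (hyd x hx (Ne.symm hxy)).1.1 ((hxd y hy hxy).2.2 trivial)

/-- `Y` embeds in `addVertex l t r`. If it used the added vertex, that vertex would have `Dom` in
the part of `Y` not of type `l`; this part is a copy of that of `r`, against the choice of `t`. -/
theorem large_mem_det [Finite V] [Nonempty V]
    (hpure : ∀ {V : Type} [Finite V] [Nonempty V] (r : V → V → Prop), (∀ x, r x x ↔ ¬l) → mk r ∈ N)
    (hX : ∀ {V : Type} [Finite V] (t : Prop) (r : V → V → Prop),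
      (∀ x, (r x x ↔ ¬l) → ¬Dom l t r x) → mk (addVertex l t r) ∈ N)
    (hr : 2 ≤ sz (¬l) r) : mk r ∈ det N := by
  intro Y h
  obtain ⟨t, ht⟩ := exists_no_dom hr
  obtain ⟨e⟩ := h.embedding' (hX t r ht) (addVertexEmb l t r)
  have hc : ∀ y, ∃ x, e y = some x := by
    intro a
    rcases ha : e a with _ | x
    · have hat : Y.E a a ↔ ¬l := by
        rw [← e.map_rel_iff, ha]
        exact Iff.rfl
      have : Nonempty {x // r x x ↔ ¬l} := (Nat.card_pos_iff.1 (lt_of_lt_of_le two_pos hr)).1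
      have hpu : ∀ x, Subrel r (fun x => r x x ↔ ¬l) x x ↔ ¬l := fun x => x.2
      obtain ⟨k⟩ := h.embedding (hpure _ hpu) (Subrel.relEmbedding r _)
      obtain ⟨⟨x, hx⟩, hkx⟩ := covers k (¬l) (by
        rw [h.sz_eq, sz_eq_card hpu]
        exact le_rfl) hat
      refine (ht x hx fun x' hx' hne => ?_).elim
      have h₁ := k.map_rel_iff (a := ⟨x, hx⟩) (b := ⟨x', hx'⟩)
      have h₂ := k.map_rel_iff (a := ⟨x', hx'⟩) (b := ⟨x, hx⟩)
      rw [hkx, ← e.map_rel_iff, ha] at h₁ h₂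
      have hty : addVertex l t r (e (k ⟨x', hx'⟩)) (e (k ⟨x', hx'⟩)) ↔ ¬l :=
        loop_map e (loop_map k (hpu ⟨x', hx'⟩))
      rcases hz : e (k ⟨x', hx'⟩) with _ | z
      · have hxx := k.injective (e.injective (hz.trans (ha.symm.trans (congrArg e hkx.symm))))
        exact (hne (Subtype.mk.inj hxx)).elim
      · rw [hz] at h₁ h₂ hty
        have := addVertex_none (t := t) hty
        exact ⟨h₁.symm.trans this.1, h₂.symm.trans this.2⟩
    · exact ⟨x, rfl⟩
  choose c hc using hc
  refine h.eq_of_embedding' ⟨⟨c, fun a b hab => e.injective (by rw [hc, hc, hab])⟩, fun {a b} => ?_⟩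
  rw [← e.map_rel_iff, hc, hc]
  rfl

theorem card_eq_sz [Finite V] (r : V → V → Prop) (l : Prop) : Nat.card V = sz l r + sz (¬l) r := by
  classical
  rw [sz, sz, ← Nat.card_sum]
  refine Nat.card_congr ((Equiv.sumCompl fun x => (r x x ↔ l)).symm.trans
    ((Equiv.refl _).sumCongr (Equiv.subtypeEquivRight fun x => iff_not_iff)))

theorem small_mem_det [Finite V] [Nonempty V] (hr : Nat.card V ≤ 4) : mk r ∈ det N := by
  intro Y h
  have : Fintype V := Fintype.ofFinite V
  obtain ⟨g⟩ : Nonempty (V ↪ Fin 4) := Function.Embedding.nonempty_of_card_le (by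
    rwa [Fintype.card_fin, ← Nat.card_eq_fintype_card])
  obtain ⟨w, hw⟩ := h.types (Function.invFun g)
  have hinv : ∀ x, Function.invFun g (g x) = x := Function.leftInverse_invFun g.injective
  refine h.eq_of_embedding ⟨⟨fun x => w (g x), fun x y hxy => ?_⟩, fun {x y} => ?_⟩
  · have := (hw _ _).2.1 hxy
    rwa [hinv, hinv] at this
  · have := (hw (g x) (g y)).1
    rwa [hinv, hinv] at this

end

/-- The rounds reach, in turn: points joined to their whole chain; points with any label; labelled
pairs of the type opposite to the chain; labelled digraphs of that type; digraphs with all loops or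
none; labelled pairs of mixed type; labelled digraphs with long chains; digraphs with an added
vertex; everything. -/
theorem det_chain : det^[9] linears = Set.univ := by
  obtain ⟨M, hM⟩ : ∃ M : ℕ → Set IsoType, M = fun i => det^[i] linears := ⟨_, rfl⟩
  have hstep : ∀ i, M (i + 1) = det (M i) := fun i => by
    simp only [hM, Function.iterate_succ_apply']
  have hmono : Monotone M := monotone_nat_of_le_succ fun i => hstep i ▸ subset_det _
  have hle : ∀ {i j : ℕ} {X : IsoType}, X ∈ M i → i ≤ j → X ∈ M j := fun h hij => hmono hij h
  have h₀ : ∀ i, linears ⊆ M i := fun i => by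
    have : linears = M 0 := by rw [hM]; rfl
    rw [this]
    exact hmono (Nat.zero_le i)
  have h₁ : ∀ l i, mk (point l i (i + 1)) ∈ M 1 := fun l i =>
    hstep 0 ▸ full_point_mem_det (h₀ 0) l i
  have h₂ : ∀ l n, ∀ p ≤ n + 1, mk (point l n p) ∈ M 2 := fun l n p hp =>
    hstep 1 ▸ point_mem_det (h₀ 1) h₁ l hp
  have h₃ : ∀ l n (s : Bool → Bool → Prop) (p : Bool → ℕ), (∀ x, s x x ↔ ¬l) →
      p false < p true → p true ≤ n + 1 → mk (lbl l n s fun _ => p) ∈ M 3 :=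
    fun l n s p hs hp hpn => hstep 2 ▸ pair_mem_det (h₀ 2) (h₂ l n) hs hp hpn
  have h₄ : ∀ l n {V : Type} [Finite V] (r : V → V → Prop) (p : V → ℕ), (∀ x, r x x ↔ ¬l) →
      Function.Injective p → (∀ x, p x ≤ n + 1) → mk (lbl l n r fun _ => p) ∈ M 4 :=
    fun l n V _ r p hr hp hpn => hstep 3 ▸ opposite_mem_det (h₀ 3)
      (fun p hp => hle (h₂ l n p hp) (by omega)) (h₃ l n) hr hp hpn
  have h₅ : ∀ l {V : Type} [Finite V] [Nonempty V] (r : V → V → Prop), (∀ x, r x x ↔ ¬l) →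
      mk r ∈ M 5 :=
    fun l V _ _ r hr => hstep 4 ▸ pure_mem_det (fun n p => h₄ l n r p hr) hr
  have h₅' : ∀ l {i : ℕ} {V : Type} [Finite V] [Nonempty V] (r : V → V → Prop), 5 ≤ i →
      (∀ x, r x x ↔ l) → mk r ∈ M i :=
    fun l i V _ _ r hi hr => hle (h₅ (¬l) r (by rwa [not_not])) hi
  have h₆ : ∀ l n (s : Bool → Bool → Prop) (p : Bool → ℕ), Function.Injective p →
      (∀ x, p x ≤ n + 1) → 2 ≤ n → (s false false ↔ ¬l) → (s true true ↔ l) →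
      mk (lbl l n s fun _ => p) ∈ M 6 :=
    fun l n s p hp hpn hn hs hs' => hstep 5 ▸ mixed_pair_mem_det (fun r => h₅' l r le_rfl)
      (fun r p hr hp hpn => hle (h₄ l n r p hr hp hpn) (by omega)) hp hpn hn hs hs'
  have h₇ : ∀ l {W : Type} [Finite W] (n : ℕ) (s : W → W → Prop) (p : W → ℕ),
      Function.Injective p → (∀ x, p x ≤ n + 1) → Nat.card W ≤ n → 2 ≤ n →
      mk (lbl l n s fun _ => p) ∈ M 7 := by
    intro l W _ n s p hp hpn hW hn
    rw [hstep 6]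
    refine mixed_mem_det (fun r => h₅' l r (by omega))
      (fun r p hr hp hpn => hle (h₄ l n r p hr hp hpn) (by omega)) hp hpn hW ?_
    intro x x' hx hx' Y h
    have hne : x ≠ x' := (ne_of_type hx' hx).symm
    exact h.embedding (h₆ l n _ (fun b => p (pick x x' b)) (hp.comp (pairEmb hne s).injective)
      (fun b => hpn _) hn hx hx') (lblMap l n (pairEmb hne s) fun _ => p)
  have h₈ : ∀ l {V : Type} [Finite V] (t : Prop) (r : V → V → Prop),
      (∀ x, (r x x ↔ ¬l) → ¬Dom l t r x) → mk (addVertex l t r) ∈ M 8 :=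
    fun l V _ t r hr => hstep 7 ▸ addVertex_mem_det (h₇ l) hr
  have h₉ : ∀ X, X ∈ M 9 := by
    intro X
    rw [hstep 8, ← mk_E X]
    by_cases hX : ∃ l, 2 ≤ sz (¬l) X.E
    · obtain ⟨l, hl⟩ := hX
      exact large_mem_det (fun r hr => h₅' (¬l) r (by omega) hr) (h₈ l) hl
    -- At most one vertex of each loop type is left, so a single pattern shows the whole digraph.
    · push Not at hX
      refine small_mem_det ?_
      have h₁ := hX False
      have h₂ := hX True
      rw [not_false_eq_true] at h₁
      have := card_eq_sz X.E True
      omega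
  rw [hM] at h₉
  exact Set.eq_univ_of_forall h₉

/-- Decoding is definable. -/
theorem Def.decode {α : Type} (i j k : α) :
    Def fun v => ∃ n, v j = DigraphOrder.num n ∧ v i = of (dec n (v k)) := by
  have h : ∀ m, Coded (det^[m] linears) := by
    intro m
    induction m with
    | zero => exact coded_linears
    | succ m ih =>
      rw [Function.iterate_succ_apply']
      exact ih.det
  refine (h 9 i j k).congr fun v => ?_
  simp [Code, det_chain]

open SOContext

/-! ### Translation of second-order formulas -/

/-- The first-order variables that represent the variables of a context: a digraph is represented
by its size and its edge relation, a vertex by its number, and a relation of arity `k` by an index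
set and `k` binary relations between indices and vertices. -/
inductive Var (c : SOContext) : Type
  | size (i : c.Dig)
  | code (i : c.Dig)
  | vtx {i : c.Dig} (x : c.Vtx i)
  | rel {k : ℕ} {s : Fin k → c.Dig} (R : c.Rel s) (j : Fin (k + 1))

/-- The tuple `y` belongs to the relation coded by `x`. -/
def TupleMem {k : ℕ} (x : Fin (k + 1) → IsoType) (y : Fin k → IsoType) : Prop :=
  ∃ T, (∃ n, T = num n) ∧ Mem (x 0) T T ∧ ∀ j, Mem (x j.succ) T (y j)

/-- The valuation `v` represents the assignment `a`. -/
structure Rep {c : SOContext} (v : Var c → IsoType) (a : c.Assignment) : Prop where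
  size : ∀ i, v (.size i) = num (a.dig i).n
  code : ∀ i (x y : (a.dig i).V), Mem (v (.code i)) (num x) (num y) ↔ (a.dig i).E x y
  vtx : ∀ i (x : c.Vtx i), v (.vtx x) = num (a.vtx i x)
  rel : ∀ k (s : Fin k → c.Dig) (R : c.Rel s) (x : ∀ j, (a.dig (s j)).V),
    x ∈ a.rel k s R ↔ TupleMem (fun j => v (.rel R j)) fun j => num (x j)

theorem Def.tupleMem {α : Type} {k : ℕ} (x : Fin (k + 1) → α) (y : Fin k → α) :
    Def fun v => TupleMem (fun j => v (x j)) fun j => v (y j) :=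
  .ex (.and (.num _) (.and (.mem _ _ _) (.forall_fin fun _ => .mem _ _ _)))

/-- The tuples of `S` are numbered, and the `j`-th binary relation sends a number to the `j`-th
coordinate. In arity `0` only the index set tells the empty relation from the full one. -/
theorem exists_tuple_code {k : ℕ} {n : Fin k → ℕ} (S : Set (∀ j, Fin (n j + 1))) :
    ∃ x : Fin (k + 1) → IsoType, ∀ y : ∀ j, Fin (n j + 1),
      y ∈ S ↔ TupleMem x fun j => num (y j) := by
  let e := Finite.equivFin S
  obtain ⟨T, hT⟩ := exists_code (fun i j => i = j ∧ i < Nat.card S) (Nat.card S)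
    fun i j h => by omega
  have : ∀ j, ∃ T, ∀ i b, Mem T (num i) (num b) ↔
      ∃ h : i < Nat.card S, ((e.symm ⟨i, h⟩).1 j : ℕ) = b := fun j =>
    exists_code _ (Nat.card S + n j) (by
      rintro i b ⟨h, rfl⟩
      have := ((e.symm ⟨i, h⟩).1 j).2
      omega)
  choose U hU using this
  refine ⟨Fin.cons T U, fun y => ⟨fun hy => ⟨num (e ⟨y, hy⟩), ⟨_, rfl⟩, ?_, fun j => ?_⟩, ?_⟩⟩
  · exact (hT _ _).2 ⟨rfl, (e ⟨y, hy⟩).2⟩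
  · rw [Fin.cons_succ, hU]
    exact ⟨(e ⟨y, hy⟩).2, by rw [Fin.eta, e.symm_apply_apply]⟩
  · rintro ⟨-, ⟨i, rfl⟩, h₀, h⟩
    have hi := ((hT _ _).1 h₀).2
    have : y = (e.symm ⟨i, hi⟩).1 := funext fun j => by
      have := h j
      rw [Fin.cons_succ, hU] at this
      exact Fin.ext this.2.symm
    rw [this]
    exact (e.symm ⟨i, hi⟩).2

/-- The variables after adding a digraph variable. -/
def Var.addDig {c : SOContext} : Var c.addDig → Var c ⊕ Bool
  | .size none => .inr false
  | .size (some i) => .inl (.size i)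
  | .code none => .inr true
  | .code (some i) => .inl (.code i)
  | .vtx (VtxLift.old x) => .inl (.vtx x)
  | .rel (RelLift.old R) j => .inl (.rel R j)

/-- The variables after adding a vertex variable. -/
def Var.addVtx {c : SOContext} {i : c.Dig} : Var (c.addVtx i) → Var c ⊕ Unit
  | .size i => .inl (.size i)
  | .code i => .inl (.code i)
  | .vtx (VtxExt.old x) => .inl (.vtx x)
  | .vtx VtxExt.new => .inr ()
  | .rel R j => .inl (.rel (c := c) R j)

/-- The variables after adding a relation variable. -/
def Var.addRel {c : SOContext} {m : ℕ} {t : Fin m → c.Dig} :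
    Var (c.addRel t) → Var c ⊕ Fin (m + 1)
  | .size i => .inl (.size i)
  | .code i => .inl (.code i)
  | .vtx x => .inl (.vtx (c := c) x)
  | .rel (RelExt.old R) j => .inl (.rel R j)
  | .rel RelExt.new j => .inr j

section

variable {c : SOContext} {v : Var c → IsoType} {a : c.Assignment}

theorem Rep.addDig (h : Rep v a) {x : Bool → IsoType} {G : FinDigraph} (h₁ : x false = num G.n)
    (h₂ : ∀ y z : G.V, Mem (x true) (num y) (num z) ↔ G.E y z) :
    Rep (fun u => Sum.elim v x u.addDig) (a.addDig G) where
  size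
    | none => h₁
    | some i => h.size i
  code
    | none => h₂
    | some i => h.code i
  vtx
    | _, VtxLift.old x => h.vtx _ x
  rel
    | _, _, RelLift.old R => h.rel _ _ R

theorem Rep.addVtx (h : Rep v a) {i : c.Dig} {x : Unit → IsoType} {y : (a.dig i).V}
    (hx : x () = num y) : Rep (fun u => Sum.elim v x (Var.addVtx (i := i) u)) (a.addVtx i y) where
  size := h.size
  code := h.code
  vtx
    | _, VtxExt.old x => h.vtx _ x
    | _, VtxExt.new => hx
  rel := h.rel

theorem Rep.addRel (h : Rep v a) {m : ℕ} {t : Fin m → c.Dig} {x : Fin (m + 1) → IsoType}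
    {S : Set (∀ j, (a.dig (t j)).V)} (hx : ∀ y, y ∈ S ↔ TupleMem x fun j => num (y j)) :
    Rep (fun u => Sum.elim v x (Var.addRel (t := t) u)) (a.addRel t S) where
  size := h.size
  code := h.code
  vtx := h.vtx
  rel
    | _, _, RelExt.old R => h.rel _ _ R
    | _, _, RelExt.new => hx

end

theorem Def.alls_elim {α β γ : Type} [Finite β] {q : (α → IsoType) → (β → IsoType) → Prop}
    {p : (γ → IsoType) → Prop} (f : γ → α ⊕ β) (hp : Def p)
    (hq : Def fun w : α ⊕ β → IsoType => q (fun a => w (.inl a)) fun b => w (.inr b)) :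
    Def fun v => ∀ x, q v x → p fun u => Sum.elim v x (f u) := by
  refine .alls (.imp hq ((hp.comp f).congr fun w => ?_))
  rw [show (Sum.elim (fun a => w (.inl a)) fun b => w (.inr b)) = w from
    Sum.elim_comp_inl_inr w]

/-- Quantifiers are guarded so that exactly the representing values remain: a size must be a number
and a vertex at most the size. Edge codes and relation codes need no guard, as everything codes
something. -/
theorem exists_translation {c : SOContext} (φ : SOFormula c) :
    ∃ p : (Var c → IsoType) → Prop, Def p ∧ ∀ v a, Rep v a → (p v ↔ φ.Realize a) := by
  induction φ with
  | falsum => exact ⟨fun _ => False, .const _, fun _ _ _ => Iff.rfl⟩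
  | eq x y =>
    refine ⟨fun v => v (.vtx x) = v (.vtx y), .eq _ _, fun v a h => ?_⟩
    change v _ = v _ ↔ _
    rw [h.vtx, h.vtx, num_inj]
    exact Iff.rfl
  | @edge c i x y =>
    refine ⟨fun v => Mem (v (.code i)) (v (.vtx x)) (v (.vtx y)), .mem _ _ _, fun v a h => ?_⟩
    change Mem _ (v _) (v _) ↔ _
    rw [h.vtx, h.vtx, h.code]
    exact Iff.rfl
  | mem R x =>
    refine ⟨fun v => TupleMem (fun j => v (.rel R j)) fun j => v (.vtx (x j)), .tupleMem _ _,
      fun v a h => ?_⟩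
    simp only [h.vtx]
    exact (h.rel _ _ R _).symm
  | imp φ ψ hφ hψ =>
    obtain ⟨p, hp, hp'⟩ := hφ
    obtain ⟨q, hq, hq'⟩ := hψ
    exact ⟨fun v => p v → q v, hp.imp hq, fun v a h => imp_congr (hp' v a h) (hq' v a h)⟩
  | allDig φ hφ =>
    obtain ⟨p, hp, hp'⟩ := hφ
    refine ⟨_, Def.alls_elim (q := fun _ x => ∃ n, x false = num n) Var.addDig hp (.num _),
      fun v a h => ⟨fun hall G => ?_, ?_⟩⟩
    · obtain ⟨S, hS⟩ := exists_code_fin G.E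
      exact (hp' _ _ (h.addDig (x := fun b => if b then S else num G.n) rfl hS)).1
        (hall _ ⟨_, rfl⟩)
    · rintro hall x ⟨n, hn⟩
      exact (hp' _ _ (h.addDig (G := dec n (x true)) hn fun y z => Iff.rfl)).2 (hall _)
  | allVtx i φ hφ =>
    obtain ⟨p, hp, hp'⟩ := hφ
    refine ⟨_, Def.alls_elim (q := fun v x => x () ≤ v (.size i)) Var.addVtx hp (.le _ _),
      fun v a h => ⟨fun hall y => ?_, fun hall x hx => ?_⟩⟩
    · exact (hp' _ _ (h.addVtx (x := fun _ => num y) rfl)).1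
        (hall _ (by rw [h.size]; exact le_num_iff.2 ⟨y, rfl⟩))
    · rw [h.size, le_num_iff] at hx
      obtain ⟨y, hy⟩ := hx
      exact (hp' _ _ (h.addVtx hy)).2 (hall y)
  | allRel t φ hφ =>
    obtain ⟨p, hp, hp'⟩ := hφ
    refine ⟨_, Def.alls_elim (q := fun _ _ => True) Var.addRel hp (.const _),
      fun v a h => ⟨fun hall S => ?_, fun hall x _ => ?_⟩⟩
    · obtain ⟨x, hx⟩ := exists_tuple_code S
      exact (hp' _ _ (h.addRel hx)).1 (hall x trivial)
    · exact (hp' _ _ (h.addRel (S := {y | TupleMem x fun j => num (y j)}) fun y => Iff.rfl)).2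
        (hall _)

/-- The variables of a context with digraph variables only. -/
def Var.digraphs {n : ℕ} : Var (SOContext.digraphs n) → Fin n ⊕ Fin n × Bool
  | .size i => .inr (i, false)
  | .code i => .inr (i, true)
  | .vtx x => nomatch x
  | .rel R _ => nomatch R

/-- `Def.decode` ties each free variable to a size and a code, to which the translated formula
applies. -/
theorem def_relation {n : ℕ} (φ : SOFormula (SOContext.digraphs n)) :
    Def fun v => v ∈ φ.relation := by
  obtain ⟨p, hp, hp'⟩ := exists_translation φ
  have : Def fun v : Fin n → IsoType => ∃ x : Fin n × Bool → IsoType,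
      (∀ i, ∃ m, x (i, false) = num m ∧ v i = of (dec m (x (i, true)))) ∧
        p fun u => Sum.elim v x u.digraphs :=
    .exs (.and (.forall_fin fun _ => .decode _ _ _) ((hp.comp Var.digraphs).congr fun w => by
      rw [show (Sum.elim (fun a => w (.inl a)) fun b => w (.inr b)) = w from
        Sum.elim_comp_inl_inr w]))
  have hrep : ∀ (v : Fin n → IsoType) (x : Fin n × Bool → IsoType) (m : Fin n → ℕ),
      (∀ i, x (i, false) = num (m i)) → Rep (fun u => Sum.elim v x u.digraphs)
        (Assignment.ofDigraphs fun i => dec (m i) (x (i, true))) := fun v x m h =>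
    ⟨h, fun _ _ _ => Iff.rfl, fun _ x => (nomatch x), fun _ _ R => (nomatch R)⟩
  refine this.congr fun v => ⟨?_, ?_⟩
  · rintro ⟨x, hx, hpx⟩
    choose m hm hv using hx
    exact ⟨fun i => dec (m i) (x (i, true)), fun i => (hv i).symm,
      (hp' _ _ (hrep v x m hm)).1 hpx⟩
  · rintro ⟨G, hG, hφ⟩
    choose S hS using fun i => exists_dec (G i)
    refine ⟨fun q => if q.2 then S q.1 else num (G q.1).n, fun i => ⟨(G i).n, rfl, ?_⟩, ?_⟩
    · simp [hS, hG]
    · refine (hp' _ _ (hrep v _ (fun i => (G i).n) fun i => rfl)).2 ?_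
      simpa [hS] using hφ

/-! ### Single digraphs and connectedness -/

/-- `num k` is the least number different from all `num m` with `m < k`. -/
theorem Def.eq_num {α : Type} (k : ℕ) (i : α) : Def fun v => v i = DigraphOrder.num k := by
  induction k using Nat.strong_induction_on generalizing α with
  | _ k ih =>
    have : Def fun v : α → IsoType => (∃ n, v i = DigraphOrder.num n) ∧
        (∀ m : Fin k, v i ≠ DigraphOrder.num m) ∧ ∀ J, (∃ n, J = DigraphOrder.num n) →
          (∀ m : Fin k, J ≠ DigraphOrder.num m) → v i ≤ J :=
      .and (.num _) (.and (.forall_fin fun m => (ih m m.2 _).not)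
        (.all (.imp (.num _) (.imp (.forall_fin fun m => (ih m m.2 _).not) (.le _ _)))))
    refine this.congr fun v => ?_
    constructor
    · rintro ⟨⟨n, hn⟩, h₁, h₂⟩
      have h₃ := h₂ (DigraphOrder.num k) ⟨k, rfl⟩ fun m h => by
        have := lin_injective.1 h
        omega
      rw [hn, lin_le_lin] at h₃
      rcases h₃.lt_or_eq with h | h
      · exact (h₁ ⟨n, h⟩ hn).elim
      · rw [hn, h]
    · rintro h
      refine ⟨⟨k, h⟩, fun m hm => ?_, ?_⟩
      · have := lin_injective.1 (h.symm.trans hm)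
        omega
      · rintro _ ⟨n, rfl⟩ hn
        rw [h, lin_le_lin]
        exact not_lt.1 fun hlt => hn ⟨n, hlt⟩ rfl

theorem Def.singleton {α : Type} (G : IsoType) (i : α) : Def fun v => v i = G := by
  obtain ⟨k, S₀, rfl⟩ := exists_of_dec G
  have : Def fun v : α → IsoType => ∃ K S, (∃ n, K = DigraphOrder.num n ∧ v i = of (dec n S)) ∧
      K = DigraphOrder.num k ∧ ∃ w : Fin (k + 1) → IsoType, (∀ a, w a = DigraphOrder.num a) ∧
        ∀ a b, Mem S (w a) (w b) ↔ (dec k S₀).E a b :=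
    .ex (.ex (.and (.decode _ _ _) (.and (.eq_num _ _) (.exs (.and
      (.forall_fin fun _ => .eq_num _ _) (.forall_fin fun _ => .forall_fin fun _ => .iff (.mem _ _ _) (.const _)))))))
  refine this.congr fun v => ?_
  constructor
  · rintro ⟨K, S, ⟨n, hn, hS⟩, hk, w, hw, h⟩
    obtain rfl := lin_injective.1 (hn.symm.trans hk)
    rw [hS]
    congr 1
    simp only [hw] at h
    simp only [dec, FinDigraph.mk.injEq, heq_eq_eq, true_and]
    congr 1
    ext a b
    exact h a b
  · intro h
    exact ⟨_, S₀, ⟨k, rfl, h⟩, rfl, fun a => DigraphOrder.num a, fun a => rfl, fun a b => Iff.rfl⟩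

/-- Closed sets of vertices replace paths, because a set can be coded, on the diagonal of a binary
relation. -/
theorem weaklyConnected_iff {G : FinDigraph} : G.WeaklyConnected ↔ ∀ A : G.V → Prop, (∃ i, A i) →
    (∀ i j, A i → (G.E i j ∨ G.E j i) → A j) → ∀ j, A j := by
  constructor
  · rintro h A ⟨i, hi⟩ hA j
    obtain ⟨w⟩ := h.preconnected i j
    induction w with
    | nil => exact hi
    | cons hadj w ih =>
      refine ih (hA _ _ hi ?_)
      exact ((SimpleGraph.fromRel_adj _ _ _).1 hadj).2
  · intro h
    refine ⟨fun i => h (fun j => G.graph.toSimpleGraphInclusive.Reachable i j) ⟨i, .refl i⟩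
      fun j k hj hjk => ?_⟩
    by_cases hne : j = k
    · exact hne ▸ hj
    · exact hj.trans (SimpleGraph.Adj.reachable ((SimpleGraph.fromRel_adj _ _ _).2 ⟨hne, hjk⟩))

theorem def_weaklyConnected {α : Type} (i : α) : Def fun v => v i ∈ weaklyConnected := by
  have : Def fun v : α → IsoType => ∃ K S, (∃ n, K = num n ∧ v i = of (dec n S)) ∧
      ∀ T, (∃ i, i ≤ K ∧ Mem T i i) → (∀ i, i ≤ K → ∀ j, j ≤ K → Mem T i i →
        (Mem S i j ∨ Mem S j i) → Mem T j j) → ∀ j, j ≤ K → Mem T j j :=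
    .ex (.ex (.and (.decode _ _ _) (.all (.imp (.ex (.and (.le _ _) (.mem _ _ _)))
      (.imp (.all (.imp (.le _ _) (.all (.imp (.le _ _) (.imp (.mem _ _ _)
        (.imp (.or (.mem _ _ _) (.mem _ _ _)) (.mem _ _ _)))))))
        (.all (.imp (.le _ _) (.mem _ _ _))))))))
  have key : ∀ n S, (dec n S).WeaklyConnected ↔ ∀ T, (∃ i, i ≤ num n ∧ Mem T i i) →
      (∀ i, i ≤ num n → ∀ j, j ≤ num n → Mem T i i → (Mem S i j ∨ Mem S j i) → Mem T j j) →
        ∀ j, j ≤ num n → Mem T j j := by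
    intro n S
    simp only [weaklyConnected_iff, forall_le_num, exists_le_num]
    constructor
    · exact fun h T => h fun i => Mem T (num i) (num i)
    · intro h A h₁ h₂
      obtain ⟨T, hT⟩ := exists_code_fin (m := n) (n := n) fun i j => i = j ∧ A i
      have hT' : ∀ i : Fin (n + 1), Mem T (num i) (num i) ↔ A i := fun i => by simp [hT]
      have := h T
      simp only [hT'] at this
      exact this h₁ h₂
  refine this.congr fun v => ⟨?_, ?_⟩
  · rintro ⟨K, S, ⟨n, rfl, hS⟩, h⟩
    exact ⟨dec n S, hS.symm, (key n S).2 h⟩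
  · rintro ⟨G, hG, h⟩
    obtain ⟨S, hS⟩ := exists_dec G
    refine ⟨_, S, ⟨G.n, rfl, by rw [hS, hG]⟩, (key _ S).1 (by rwa [hS])⟩

end DigraphOrder
open DigraphOrder FirstOrder in
theorem corollary2 :
    ∃ C : Finset IsoType,
      (∀ G : IsoType, (C : Set IsoType).Definable₁ Language.order {G}) ∧
      (C : Set IsoType).Definable₁ Language.order IsoType.weaklyConnected ∧
      ∀ (n : ℕ) (φ : SOFormula (SOContext.digraphs n)),
        (C : Set IsoType).Definable Language.order φ.relation :=
  ⟨small, fun G => Def.singleton G 0, def_weaklyConnected 0, fun _ φ => def_relation φ⟩
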